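/- **Conventions.** Work in (non-negatively graded) complexes of $\mathbb{Z}$-modules; the degree is called dimension and written $|x|$. A nonsymmetric graded operad is given by partial compositions $\circ_i$ satisfying the unit axioms, $(x\circ_i y)\circ_{i+j-1}z=x\circ_i(y\circ_j z)$, and $(x\circ_i y)\circ_{j+n-1}z=(-1)^{|y||z|}(x\circ_j z)\circ_i y$ for $i<j$ and $y$ of arity $n$. A differential on it has degree $-1$, square zero, and satisfies $d(x\circ_i y)=dx\circ_i y+(-1)^{|x|}x\circ_i dy$. **Quadratic duality.** Consider a presentation by a finite graded basis $G$ of generators of arity $2$, a module $R$ of quadratic relations, and a linear map $d$ on the span of $G$. Its quadratic (Koszul) dual has as generators the dual basis (same dimensions), as relations the orthogonal of $R$ for the pairing in which the bases $a\circ_1 b$ and $a^*\circ_1 b^*$ are dual, the bases $a\circ_2 b$ and $a^*\circ_2b^*$ are dual up to the sign $-1$, and $\circ_1$-terms are orthogonal to $\circ_2$-terms; its differential on generators is the transpose of $d$. **The operad $K'$** (associahedra), through its quadratic presentation: generators $<,>$ of dimension $0$ and $|$ of dimension $1$, with $d(<)=-d(>)=|$, $d(|)=0$, and relations $>\circ_2<\;=\;<\circ_1>$,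 $\;>\circ_2>\;=\;>\circ_1>+>\circ_1<$, $\;<\circ_1<\;=\;<\circ_2<+<\circ_2>$, $\;>\circ_2|\;=\;|\circ_1>$, $\;<\circ_1|\;=\;|\circ_2<$, $\;|\circ_1<\;=\;|\circ_2>$, $\;|\circ_1|\;=\;-|\circ_2|$. **The operad $\mathrm{Trias}'$** is the quotient of the free nonsymmetric graded operad on $\dashv,\vdash$ of dimension $0$ and $\times$ of dimension $1$ by the ideal generated by $\dashv\circ_1\vdash\;=\;\vdash\circ_2\dashv$, $\;\dashv\circ_2\dashv\;=\;\dashv\circ_2\vdash$, $\;\dashv\circ_1\dashv\;=\;\dashv\circ_2\vdash$, $\;\vdash\circ_1\vdash\;=\;\vdash\circ_1\dashv$, $\;\vdash\circ_2\vdash\;=\;\vdash\circ_1\dashv$, $\;\times\circ_1\vdash\;=\;\vdash\circ_2\times$, $\;\times\circ_2\dashv\;=\;\dashv\circ_1\times$, $\;\times\circ_1\dashv\;=\;\times\circ_2\vdash$, $\;\vdash\circ_1\times=0$, $\;\dashv\circ_2\times=0$, $\;\times\circ_1\times=-\times\circ_2\times$. **The symmetric operad $\mathrm{Pasc}$.**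 For a finite set $I$ let $\mathrm{Ex}(I)$ be the exterior algebra on the free $\mathbb{Z}$-module with basis $(e_i)_{i\in I}$, let $\theta_i$ be its left antiderivation of degree $-1$ with $\theta_i(e_j)=\delta_{ij}$, and let $d=\sum_i\theta_i$. Then $\mathrm{Pasc}(I)$ is the quotient complex of $\mathrm{Ex}(I)$ by the unit, with $\dim\big(\bigwedge_{i\in P}e_i\big)=|P|-1$. For $x=\bigwedge_{a\in P}e_a\in\mathrm{Pasc}(I)$, $y=\bigwedge_{b\in Q}e_b\in\mathrm{Pasc}(J)$ with $P,Q$ nonempty and $i\in I$, the composite $x\circ_i y\in \mathrm{Pasc}((I\setminus\{i\})\sqcup J)$ is $(-1)^{\dim x}\theta_i(x\wedge y)$ if $i\in P$; it is $x$ if $i\notin P$ and $\dim y=0$; it is $0$ if $i\notin P$ and $\dim y>0$. The unit is $e_1\in \mathrm{Pasc}(\{1\})$. Write $\mathrm{Pasc}_{\not\Sigma}$ for the nonsymmetric operad with components $\mathrm{Pasc}(\{1,\dots,n\})$ obtained by forgetting the actions of the symmetric groups. **Proposition.** 1. With $\dashv,\vdash,\times$ the dual basis of $<,>,|$, the quadratic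 dual of the presentation of $K'$ has as relations exactly the module spanned by the eleven relations of $\mathrm{Trias}'$, and as differential on generators $d(\times)=\dashv-\vdash$, $d(\dashv)=d(\vdash)=0$; that is, $\mathrm{Trias}'$ is the Koszul dual of $K'$. 2. $\mathrm{Trias}'$ is a nonsymmetric graded operad, and $\mathrm{Pasc}_{\not\Sigma}$ is a nonsymmetric differential graded operad. There is exactly one operadic differential on $\mathrm{Trias}'$ with $d(\times)=\dashv-\vdash$ and $d(\dashv)=d(\vdash)=0$. With this differential, $\mathrm{Trias}'$ is isomorphic, as a nonsymmetric differential graded operad, to $\mathrm{Pasc}_{\not\Sigma}$. -/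

import Mathlib

/-! ## Nonsymmetric operads in graded abelian groups

Everything is over `ℤ`.  Degrees (called dimensions) are natural numbers, which covers all the
complexes that occur here.  Partial compositions `x ∘ᵢ y` use a zero-based position `i : Fin m`,
so that `∘₁` is position `0`.  The arity and the degree of a composite are passed as equations
`m + n = r + 1` and `k + l = s`, which avoids all casts between graded pieces. -/

/-- The data of a nonsymmetric operad in graded abelian groups: components `obj n k` (arity `n`,
dimension `k`), a unit and biadditive partial compositions. -/
structure NSOperad where
  obj : ℕ → ℕ → Type
  [grp : ∀ n k, AddCommGroup (obj n k)]
  unit : obj 1 0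
  comp : ∀ {m n r k l s : ℕ}, m + n = r + 1 → k + l = s → Fin m → (obj m k →+ obj n l →+ obj r s)

attribute [instance] NSOperad.grp

namespace NSOperad

/-- The axioms of a nonsymmetric operad in graded abelian groups, with the Koszul sign rule in the
parallel composition axiom. -/
structure IsOperad (P : NSOperad) : Prop where
  unit_comp : ∀ {n l : ℕ} (y : P.obj n l),
    P.comp (Nat.add_comm 1 n) (Nat.zero_add l) (0 : Fin 1) P.unit y = y
  comp_unit : ∀ {m k : ℕ} (i : Fin m) (x : P.obj m k), P.comp rfl (Nat.add_zero k) i x P.unit = x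
  assoc : ∀ {m n p r t u k l q s v w : ℕ}
    (h₁ : m + n = r + 1) (h₂ : r + p = t + 1) (h₃ : n + p = u + 1) (h₄ : m + u = t + 1)
    (e₁ : k + l = s) (e₂ : s + q = v) (e₃ : l + q = w) (e₄ : k + w = v)
    (i : Fin m) (j : Fin n) (x : P.obj m k) (y : P.obj n l) (z : P.obj p q),
    P.comp h₂ e₂ ⟨i + j, by omega⟩ (P.comp h₁ e₁ i x y) z =
      P.comp h₄ e₄ i x (P.comp h₃ e₃ j y z)
  parallel : ∀ {m n p r t u k l q s v w : ℕ}
    (h₁ : m + n = r + 1) (h₂ : r + p = t + 1) (h₃ : m + p = u + 1) (h₄ : u + n = t + 1)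
    (e₁ : k + l = s) (e₂ : s + q = v) (e₃ : k + q = w) (e₄ : w + l = v)
    (i j : Fin m) (hij : (i : ℕ) < j) (x : P.obj m k) (y : P.obj n l) (z : P.obj p q),
    P.comp h₂ e₂ ⟨j + n - 1, by omega⟩ (P.comp h₁ e₁ i x y) z =
      (-1 : ℤ) ^ (l * q) • P.comp h₄ e₄ ⟨i, by omega⟩ (P.comp h₃ e₃ j x z) y

/-- Families of additive maps lowering the dimension by one (and implicitly zero on dimension
`0`). -/
abbrev Lowering (P : NSOperad) : Type := ∀ n k : ℕ, P.obj n (k + 1) →+ P.obj n k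

/-- `d` makes `P` a differential graded operad: `d ∘ d = 0` and
`d (x ∘ᵢ y) = d x ∘ᵢ y + (-1) ^ dim x • x ∘ᵢ d y`.  The Leibniz rule is written as three cases since
`d` vanishes on dimension `0`. -/
structure IsDifferential (P : NSOperad) (d : P.Lowering) : Prop where
  d_d : ∀ {n k : ℕ} (x : P.obj n (k + 2)), d n k (d n (k + 1) x) = 0
  leibniz_left : ∀ {m n r k s : ℕ} (h : m + n = r + 1) (e : (k + 1) + 0 = s + 1) (e' : k + 0 = s)
    (i : Fin m) (x : P.obj m (k + 1)) (y : P.obj n 0),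
    d r s (P.comp h e i x y) = P.comp h e' i (d m k x) y
  leibniz_right : ∀ {m n r l s : ℕ} (h : m + n = r + 1) (e : 0 + (l + 1) = s + 1) (e' : 0 + l = s)
    (i : Fin m) (x : P.obj m 0) (y : P.obj n (l + 1)),
    d r s (P.comp h e i x y) = P.comp h e' i x (d n l y)
  leibniz : ∀ {m n r k l s : ℕ} (h : m + n = r + 1) (e : (k + 1) + (l + 1) = s + 1)
    (e₁ : k + (l + 1) = s) (e₂ : (k + 1) + l = s)
    (i : Fin m) (x : P.obj m (k + 1)) (y : P.obj n (l + 1)),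
    d r s (P.comp h e i x y) =
      P.comp h e₁ i (d m k x) y + (-1 : ℤ) ^ (k + 1) • P.comp h e₂ i x (d n l y)

/-- Isomorphisms of nonsymmetric graded operads. -/
structure Iso (P Q : NSOperad) where
  equiv : ∀ n k : ℕ, P.obj n k ≃+ Q.obj n k
  map_unit : equiv 1 0 P.unit = Q.unit
  map_comp : ∀ {m n r k l s : ℕ} (h : m + n = r + 1) (e : k + l = s) (i : Fin m)
    (x : P.obj m k) (y : P.obj n l),
    equiv r s (P.comp h e i x y) = Q.comp h e i (equiv m k x) (equiv n l y)

/-! ### Operadic ideals and quotients -/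

/-- Membership in the operadic ideal generated by `S`. -/
inductive InIdeal (P : NSOperad) (S : ∀ n k : ℕ, Set (P.obj n k)) : ∀ {n k : ℕ}, P.obj n k → Prop
  | of {n k : ℕ} (x : P.obj n k) (hx : x ∈ S n k) : InIdeal P S x
  | zero {n k : ℕ} : InIdeal P S (0 : P.obj n k)
  | add {n k : ℕ} (x y : P.obj n k) (hx : InIdeal P S x) (hy : InIdeal P S y) : InIdeal P S (x + y)
  | neg {n k : ℕ} (x : P.obj n k) (hx : InIdeal P S x) : InIdeal P S (-x)
  | comp_left {m n r k l s : ℕ} (h : m + n = r + 1) (e : k + l = s) (i : Fin m)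
      (x : P.obj m k) (y : P.obj n l) (hx : InIdeal P S x) : InIdeal P S (P.comp h e i x y)
  | comp_right {m n r k l s : ℕ} (h : m + n = r + 1) (e : k + l = s) (i : Fin m)
      (x : P.obj m k) (y : P.obj n l) (hy : InIdeal P S y) : InIdeal P S (P.comp h e i x y)

/-- The operadic ideal generated by `S`, in arity `n` and dimension `k`. -/
def ideal (P : NSOperad) (S : ∀ n k : ℕ, Set (P.obj n k)) (n k : ℕ) : AddSubgroup (P.obj n k) where
  carrier := {x | InIdeal P S x}
  zero_mem' := InIdeal.zero
  add_mem' := fun hx hy => InIdeal.add _ _ hx hy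
  neg_mem' := fun hx => InIdeal.neg _ hx

/-- The quotient of `P` by the operadic ideal generated by `S`. -/
def quotient (P : NSOperad) (S : ∀ n k : ℕ, Set (P.obj n k)) : NSOperad where
  obj n k := P.obj n k ⧸ P.ideal S n k
  unit := QuotientAddGroup.mk P.unit
  comp {m n r k l s} h e i :=
    QuotientAddGroup.lift (P.ideal S m k)
      { toFun := fun x => QuotientAddGroup.lift (P.ideal S n l)
          ((QuotientAddGroup.mk' (P.ideal S r s)).comp (P.comp h e i x))
          (fun y hy => (QuotientAddGroup.eq_zero_iff _).2 (InIdeal.comp_right h e i x y hy))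
        map_zero' := by
          ext y; simp
        map_add' := fun x x' => by
          ext y
          simp only [map_add]
          rfl }
      (fun x hx => by
        rw [AddMonoidHom.mem_ker]
        ext y
        exact (QuotientAddGroup.eq_zero_iff _).2 (InIdeal.comp_left h e i x y hx))

/-! ### The free operad on binary generators -/

/-- Formal operadic expressions in binary generators `g : G` of dimension `deg g`. -/
inductive Expr {G : Type} (deg : G → ℕ) : ℕ → ℕ → Type
  | unit : Expr deg 1 0
  | gen {k : ℕ} (g : G) (hg : deg g = k) : Expr deg 2 k
  | zero {n k : ℕ} : Expr deg n k
  | add {n k : ℕ} (x y : Expr deg n k) : Expr deg n k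
  | neg {n k : ℕ} (x : Expr deg n k) : Expr deg n k
  | comp {m n r k l s : ℕ} (h : m + n = r + 1) (e : k + l = s) (i : Fin m)
      (x : Expr deg m k) (y : Expr deg n l) : Expr deg r s

/-- `x` multiplied by `(-1) ^ a`. -/
def Expr.signed {G : Type} {deg : G → ℕ} {n k : ℕ} (a : ℕ) (x : Expr deg n k) : Expr deg n k :=
  if Even a then x else x.neg

/-- The congruence on formal expressions generated by the axioms of abelian groups, biadditivity of
the compositions and the axioms of graded nonsymmetric operads. -/
inductive Expr.Rel {G : Type} {deg : G → ℕ} :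
    ∀ {n k : ℕ}, Expr deg n k → Expr deg n k → Prop
  | refl {n k : ℕ} (x : Expr deg n k) : Rel x x
  | symm {n k : ℕ} {x y : Expr deg n k} (h : Rel x y) : Rel y x
  | trans {n k : ℕ} {x y z : Expr deg n k} (h : Rel x y) (h' : Rel y z) : Rel x z
  | add_congr {n k : ℕ} {x x' y y' : Expr deg n k} (h : Rel x x') (h' : Rel y y') :
      Rel (x.add y) (x'.add y')
  | neg_congr {n k : ℕ} {x x' : Expr deg n k} (h : Rel x x') : Rel x.neg x'.neg
  | comp_congr {m n r k l s : ℕ} (h : m + n = r + 1) (e : k + l = s) (i : Fin m)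
      {x x' : Expr deg m k} {y y' : Expr deg n l} (hx : Rel x x') (hy : Rel y y') :
      Rel (.comp h e i x y) (.comp h e i x' y')
  | add_assoc {n k : ℕ} (x y z : Expr deg n k) : Rel ((x.add y).add z) (x.add (y.add z))
  | add_comm {n k : ℕ} (x y : Expr deg n k) : Rel (x.add y) (y.add x)
  | zero_add {n k : ℕ} (x : Expr deg n k) : Rel (Expr.zero.add x) x
  | neg_add {n k : ℕ} (x : Expr deg n k) : Rel (x.neg.add x) .zero
  | comp_add_left {m n r k l s : ℕ} (h : m + n = r + 1) (e : k + l = s) (i : Fin m)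
      (x x' : Expr deg m k) (y : Expr deg n l) :
      Rel (.comp h e i (x.add x') y) ((Expr.comp h e i x y).add (.comp h e i x' y))
  | comp_add_right {m n r k l s : ℕ} (h : m + n = r + 1) (e : k + l = s) (i : Fin m)
      (x : Expr deg m k) (y y' : Expr deg n l) :
      Rel (.comp h e i x (y.add y')) ((Expr.comp h e i x y).add (.comp h e i x y'))
  | unit_comp {n l : ℕ} (y : Expr deg n l) :
      Rel (.comp (Nat.add_comm 1 n) (Nat.zero_add l) (0 : Fin 1) .unit y) y
  | comp_unit {m k : ℕ} (i : Fin m) (x : Expr deg m k) :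
      Rel (.comp rfl (Nat.add_zero k) i x .unit) x
  | assoc {m n p r t u k l q s v w : ℕ}
      (h₁ : m + n = r + 1) (h₂ : r + p = t + 1) (h₃ : n + p = u + 1) (h₄ : m + u = t + 1)
      (e₁ : k + l = s) (e₂ : s + q = v) (e₃ : l + q = w) (e₄ : k + w = v)
      (i : Fin m) (j : Fin n) (x : Expr deg m k) (y : Expr deg n l) (z : Expr deg p q) :
      Rel (.comp h₂ e₂ ⟨i + j, by omega⟩ (.comp h₁ e₁ i x y) z)
        (.comp h₄ e₄ i x (.comp h₃ e₃ j y z))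
  | parallel {m n p r t u k l q s v w : ℕ}
      (h₁ : m + n = r + 1) (h₂ : r + p = t + 1) (h₃ : m + p = u + 1) (h₄ : u + n = t + 1)
      (e₁ : k + l = s) (e₂ : s + q = v) (e₃ : k + q = w) (e₄ : w + l = v)
      (i j : Fin m) (hij : (i : ℕ) < j) (x : Expr deg m k) (y : Expr deg n l) (z : Expr deg p q) :
      Rel (.comp h₂ e₂ ⟨j + n - 1, by omega⟩ (.comp h₁ e₁ i x y) z)
        (.signed (l * q) (.comp h₄ e₄ ⟨i, by omega⟩ (.comp h₃ e₃ j x z) y))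

/-- Formal expressions up to the operad axioms. -/
def FreeObj {G : Type} (deg : G → ℕ) (n k : ℕ) : Type :=
  Quot (Expr.Rel : Expr deg n k → Expr deg n k → Prop)

instance FreeObj.instAddCommGroup {G : Type} (deg : G → ℕ) (n k : ℕ) :
    AddCommGroup (FreeObj deg n k) :=
  letI : Add (FreeObj deg n k) :=
    ⟨Quot.map₂ Expr.add (fun x _ _ h => .add_congr (.refl x) h)
      (fun _ _ y h => .add_congr h (.refl y))⟩
  letI : Zero (FreeObj deg n k) := ⟨Quot.mk _ .zero⟩
  letI : Neg (FreeObj deg n k) := ⟨Quot.map Expr.neg (fun _ _ h => .neg_congr h)⟩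
  letI : AddGroup (FreeObj deg n k) := AddGroup.ofLeftAxioms
    (by rintro ⟨x⟩ ⟨y⟩ ⟨z⟩; exact Quot.sound (.add_assoc x y z))
    (by rintro ⟨x⟩; exact Quot.sound (.zero_add x))
    (by rintro ⟨x⟩; exact Quot.sound (.neg_add x))
  { (inferInstance : AddGroup (FreeObj deg n k)) with
    add_comm := by rintro ⟨x⟩ ⟨y⟩; exact Quot.sound (.add_comm x y) }

/-- The free nonsymmetric graded operad on binary generators `g : G` of dimension `deg g`. -/
def free {G : Type} (deg : G → ℕ) : NSOperad where
  obj := FreeObj deg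
  unit := Quot.mk _ .unit
  comp h e i := AddMonoidHom.mk'
    (fun x => AddMonoidHom.mk'
      (fun y => Quot.map₂ (Expr.comp h e i) (fun x _ _ hy => .comp_congr h e i (.refl x) hy)
        (fun _ _ y hx => .comp_congr h e i hx (.refl y)) x y)
      (by
        rcases x with ⟨x⟩
        rintro ⟨y⟩ ⟨y'⟩
        exact Quot.sound (.comp_add_right h e i x y y')))
    (by
      rintro ⟨x⟩ ⟨x'⟩
      ext y
      rcases y with ⟨y⟩
      exact Quot.sound (.comp_add_left h e i x x' y))

/-- A generator as an element of arity two of the free operad. -/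
def freeGen {G : Type} (deg : G → ℕ) {k : ℕ} (g : G) (hg : deg g = k) : (free deg).obj 2 k :=
  Quot.mk _ (.gen g hg)

end NSOperad

/-! ## Binary quadratic presentations and quadratic (Koszul) duality -/

/-- Binary quadratic data on a set `G` of generators.  The free operad on `G` has in arity three
the basis `a ∘₁ b`, `a ∘₂ b` with `a b : G`; these are indexed by `(0, a, b)` and `(1, a, b)`.  The
module of relations `rel` is a (homogeneous) submodule of this module.  The entry `diff g h` is the
coefficient of `h` in the differential of the generator `g`. -/
@[ext]
structure QuadData (G : Type) where
  deg : G → ℕ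
  rel : Submodule ℤ (Fin 2 × G × G → ℤ)
  diff : G → G → ℤ

namespace QuadData

/-- The pairing between the arity three parts of the free operads on `E` and on the dual of `E`:
the dual bases `a ∘₁ b` are paired with the sign `+`, the bases `a ∘₂ b` with the sign `-`. -/
def pairing {G : Type} [Fintype G] (u v : Fin 2 × G × G → ℤ) : ℤ :=
  ∑ p : G × G, u (0, p) * v (0, p) - ∑ p : G × G, u (1, p) * v (1, p)

/-- The quadratic dual: dual generators (indexed by the same set, as the dual basis), orthogonal
relations, transposed differential. -/
def dual {G : Type} [Fintype G] (Q : QuadData G) : QuadData G where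
  deg := Q.deg
  rel :=
    { carrier := {v | ∀ u ∈ Q.rel, pairing u v = 0}
      zero_mem' := by intro u _; simp [pairing]
      add_mem' := by
        intro v w hv hw u hu
        have h₁ := hv u hu
        have h₂ := hw u hu
        simp only [pairing, Pi.add_apply, mul_add, Finset.sum_add_distrib] at h₁ h₂ ⊢
        linarith
      smul_mem' := by
        intro c v hv u hu
        have h₁ := hv u hu
        have h₂ : pairing u (c • v) = c * pairing u v := by
          simp only [pairing, Pi.smul_apply, smul_eq_mul, mul_sub, Finset.mul_sum, mul_left_comm]
        rw [h₂, h₁, mul_zero] }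
  diff g h := Q.diff h g

/-- The component of dimension `k` of the arity three element
`∑ v (0, a, b) • a ∘₁ b + ∑ v (1, a, b) • a ∘₂ b` of the free operad. -/
def element {G : Type} [Fintype G] (deg : G → ℕ) (v : Fin 2 × G × G → ℤ) (k : ℕ) :
    (NSOperad.free deg).obj 3 k :=
  ∑ p : Fin 2 × G × G,
    if h : deg p.2.1 + deg p.2.2 = k then
      v p • (NSOperad.free deg).comp (m := 2) (n := 2) rfl h p.1
        (NSOperad.freeGen deg p.2.1 rfl) (NSOperad.freeGen deg p.2.2 rfl)
    else 0

/-- The relations, as elements of the free operad; they all sit in arity three. -/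
inductive Relator {G : Type} [Fintype G] (Q : QuadData G) :
    ∀ n k : ℕ, (NSOperad.free Q.deg).obj n k → Prop
  | mk (v : Fin 2 × G × G → ℤ) (hv : v ∈ Q.rel) (k : ℕ) : Relator Q 3 k (element Q.deg v k)

/-- The operad presented by `Q`: the quotient of the free operad by the ideal generated by the
relations. -/
def operad {G : Type} [Fintype G] (Q : QuadData G) : NSOperad :=
  (NSOperad.free Q.deg).quotient (fun n k => {x | Relator Q n k x})

/-- A generator as an element of the presented operad. -/
def gen {G : Type} [Fintype G] (Q : QuadData G) {k : ℕ} (g : G) (hg : Q.deg g = k) :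
    Q.operad.obj 2 k :=
  QuotientAddGroup.mk (NSOperad.freeGen Q.deg g hg)

/-- `d` is a differential on the presented operad which takes the prescribed values
`d g = ∑ h, diff g h • h` on the generators (here `diff` is of degree `-1`). -/
def IsInducedDifferential {G : Type} [Fintype G] (Q : QuadData G) (d : Q.operad.Lowering) : Prop :=
  Q.operad.IsDifferential d ∧
    ∀ (k : ℕ) (g : G) (hg : Q.deg g = k + 1),
      d 2 k (Q.gen g hg) = ∑ h : G, if e : Q.deg h = k then Q.diff g h • Q.gen h e else 0

end QuadData

/-! ## The operads `K'` and `Trias'` -/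

/-- Index set of the three generators.  For `K'`: `l` is `1 < 2`, `r` is `1 > 2` and `m` is
`1 | 2`.  For `Trias'`, in terms of the dual basis: `l` is `1 ⊣ 2`, `r` is `1 ⊢ 2` and `m` is
`1 × 2`. -/
inductive Gen3 : Type
  | l
  | r
  | m
  deriving DecidableEq

instance : Fintype Gen3 where
  elems := {.l, .r, .m}
  complete := by intro x; cases x <;> simp

namespace Gen3

/-- `l` and `r` have dimension `0`, and `m` has dimension `1`. -/
def dim : Gen3 → ℕ
  | l => 0
  | r => 0
  | m => 1

/-- The monomial `a ∘₁ b`. -/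
def c₁ (a b : Gen3) : Fin 2 × Gen3 × Gen3 → ℤ := Pi.single (0, a, b) 1

/-- The monomial `a ∘₂ b`. -/
def c₂ (a b : Gen3) : Fin 2 × Gen3 × Gen3 → ℤ := Pi.single (1, a, b) 1

end Gen3

open Gen3 in
/-- The quadratic presentation of the operad `K'` of associahedra; the differential (of degree `+1`)
is `d (1 < 2) = 1 | 2`, `d (1 > 2) = - 1 | 2`, `d (1 | 2) = 0`. -/
def kData : QuadData Gen3 where
  deg := dim
  rel := Submodule.span ℤ
    { c₂ r l - c₁ l r,
      c₂ r r - (c₁ r r + c₁ r l),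
      c₁ l l - (c₂ l l + c₂ l r),
      c₂ r m - c₁ m r,
      c₁ l m - c₂ m l,
      c₁ m l - c₂ m r,
      c₁ m m + c₂ m m }
  diff
    | l, m => 1
    | r, m => -1
    | _, _ => 0

open Gen3 in
/-- The quadratic presentation of the operad `Trias'`; the differential (of degree `-1`) is
`d (1 × 2) = 1 ⊣ 2 - 1 ⊢ 2`, `d (1 ⊣ 2) = d (1 ⊢ 2) = 0`. -/
def triasData : QuadData Gen3 where
  deg := dim
  rel := Submodule.span ℤ
    { c₁ l r - c₂ r l,
      c₂ l l - c₂ l r,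
      c₁ l l - c₂ l r,
      c₁ r r - c₁ r l,
      c₂ r r - c₁ r l,
      c₁ m r - c₂ r m,
      c₂ m l - c₁ l m,
      c₁ m l - c₂ m r,
      c₁ r m,
      c₂ l m,
      c₁ m m + c₂ m m }
  diff
    | m, l => 1
    | m, r => -1
    | _, _ => 0

/-- The nonsymmetric operad `Trias'`. -/
def Trias : NSOperad := triasData.operad

/-! ## The symmetric operad `Pasc` -/

/-- The data of a differential graded symmetric operad, indexed by (finite) sets: functoriality in
bijections, units on one point sets, partial compositions
`P(I) × P(J) → P((I ∖ {i}) ⊔ J)` and a differential of degree `-1`. -/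
structure SymOperad where
  obj : Type → ℕ → Type
  [grp : ∀ I k, AddCommGroup (obj I k)]
  relabel : ∀ {I J : Type} {k : ℕ}, I ≃ J → (obj I k →+ obj J k)
  unit : ∀ (I : Type) [Unique I], obj I 0
  comp : ∀ {I J : Type} [Fintype I] [Fintype J] {k l s : ℕ}, k + l = s → ∀ i : I,
    (obj I k →+ obj J l →+ obj ({a : I // a ≠ i} ⊕ J) s)
  d : ∀ (I : Type) [Fintype I] (k : ℕ), obj I (k + 1) →+ obj I k

attribute [instance] SymOperad.grp

/-- Insertion of `n` inputs at the position `i` of `m` inputs, in the order of the inputs. -/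
def insertFun (m n r : ℕ) (h : m + n = r + 1) (i : Fin m) : {a : Fin m // a ≠ i} ⊕ Fin n → Fin r
  | .inl a =>
      if hlt : (a.1 : ℕ) < i then ⟨a.1, by omega⟩
      else ⟨a.1 + n - 1, by
        have h₁ : (a.1 : ℕ) ≠ i := fun h' => a.2 (Fin.ext h')
        omega⟩
  | .inr j => ⟨i + j, by omega⟩

theorem insertFun_bijective (m n r : ℕ) (h : m + n = r + 1) (i : Fin m) :
    Function.Bijective (insertFun m n r h i) := by
  rw [Fintype.bijective_iff_injective_and_card]
  constructor
  · rintro (⟨a, ha⟩ | a) (⟨b, hb⟩ | b) hab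
    all_goals
      simp only [insertFun] at hab
      try have h₁ : (a : ℕ) ≠ i := fun h' => ha (Fin.ext h')
      try have h₂ : (b : ℕ) ≠ i := fun h' => hb (Fin.ext h')
      try split_ifs at hab
      all_goals
        rw [Fin.mk.injEq] at hab
        first
          | (exfalso; omega)
          | (congr 1; first | (apply Subtype.ext; apply Fin.ext; simp only; omega)
                            | (apply Fin.ext; omega))
  · have h₁ := i.2
    have h₂ : Fintype.card {a : Fin m // a ≠ i} = m - 1 := by
      rw [Fintype.card_subtype_compl, Fintype.card_fin]; simp
    rw [Fintype.card_sum, h₂, Fintype.card_fin, Fintype.card_fin]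
    omega

/-- The resulting identification of `({1, …, m} ∖ {i}) ⊔ {1, …, n}` with `{1, …, m + n - 1}`. -/
noncomputable def insertEquiv {m n r : ℕ} (h : m + n = r + 1) (i : Fin m) :
    {a : Fin m // a ≠ i} ⊕ Fin n ≃ Fin r :=
  Equiv.ofBijective _ (insertFun_bijective m n r h i)

namespace SymOperad

/-- The nonsymmetric operad `P_{Σ̸}` obtained from a symmetric operad by forgetting the actions of
the symmetric groups: its arity `n` component is `P({1, …, n})`. -/
noncomputable def forget (P : SymOperad) : NSOperad where
  obj n k := P.obj (Fin n) k
  unit := P.unit (Fin 1)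
  comp h e i := ((P.relabel (insertEquiv h i)).compHom).comp (P.comp e i)

/-- The differential of a symmetric operad, on the associated nonsymmetric operad. -/
def forgetD (P : SymOperad) : P.forget.Lowering := fun n k => P.d (Fin n) k

end SymOperad

namespace Pasc

/-- The exterior algebra `Ex(I)` of the free module with basis `e i`, `i : I`. -/
abbrev Ex (I : Type) : Type := ExteriorAlgebra ℤ (I →₀ ℤ)

/-- The basis element `e i` in the exterior algebra. -/
noncomputable def e {I : Type} (i : I) : Ex I := ExteriorAlgebra.ι ℤ (Finsupp.single i 1)

/-- The left antiderivation of degree `-1` of the exterior algebra with `φ` as its values on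
generators. -/
noncomputable def contract {I : Type} (φ : (I →₀ ℤ) →ₗ[ℤ] ℤ) : Ex I →ₗ[ℤ] Ex I :=
  CliffordAlgebra.contractLeft (Q := (0 : QuadraticForm ℤ (I →₀ ℤ))) φ

/-- The left antiderivation `θ i` of degree `-1`, with `θ i (e j) = δ i j`. -/
noncomputable def θ {I : Type} (i : I) : Ex I →ₗ[ℤ] Ex I := contract (Finsupp.lapply i)

/-- The differential `∑ i, θ i` of the exterior algebra. -/
noncomputable def dEx (I : Type) [Fintype I] : Ex I →ₗ[ℤ] Ex I := ∑ i : I, θ i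

/-- The algebra map `Ex(I) → Ex(J)` induced by a map `I → J`. -/
noncomputable def push {I J : Type} (f : I → J) : Ex I →ₐ[ℤ] Ex J :=
  ExteriorAlgebra.map (Finsupp.lmapDomain ℤ ℤ f)

theorem inclusion_injective (I J : Type) (i : I) :
    Function.Injective (Sum.map Subtype.val id : {a : I // a ≠ i} ⊕ J → I ⊕ J) :=
  Subtype.val_injective.sumMap Function.injective_id

/-- The algebra map `Ex(I ⊔ J) → Ex((I ∖ {i}) ⊔ J)` which kills `e i` and fixes the other basis
elements.  It is only used on elements that do not involve `e i`, where it is the canonical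
identification. -/
noncomputable def restrict {I : Type} (J : Type) (i : I) :
    Ex (I ⊕ J) →ₐ[ℤ] Ex ({a : I // a ≠ i} ⊕ J) :=
  ExteriorAlgebra.map (Finsupp.lcomapDomain _ (inclusion_injective I J i))

/-- The composition `x ∘ᵢ y` for `x` of dimension `k` and `y` of dimension `l`.

If `x` is a product of basis elements containing `e i` then the first summand is
`(-1) ^ k • θ i (x ∧ y)` and the second one vanishes.  If `x` is a product of basis elements
different from `e i`, then the first summand vanishes, and the second one is `x` if `y = e j`
(one has `θ i (e i ∧ x) = x` and `d (e j) = 1` in the exterior algebra) and zero if `l > 0`. -/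
noncomputable def compEx {I J : Type} [Fintype J] (k l : ℕ) (i : I) :
    Ex I →ₗ[ℤ] Ex J →ₗ[ℤ] Ex ({a : I // a ≠ i} ⊕ J) :=
  LinearMap.mk₂ ℤ
    (fun x y =>
      restrict J i ((-1 : ℤ) ^ k • θ (Sum.inl i) (push Sum.inl x * push Sum.inr y)
        + if l = 0 then push Sum.inl (θ i (e i * x)) * push Sum.inr (dEx J y) else 0))
    (by intro x x' y; split_ifs <;> simp only [map_add, add_mul, mul_add, smul_add, add_zero]; abel)
    (by
      intro c x y
      split_ifs <;>
        simp only [map_smul, smul_mul_assoc, mul_smul_comm, smul_add, map_add, add_zero,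
          smul_comm c ((-1 : ℤ) ^ k)])
    (by intro x y y'; split_ifs <;> simp only [map_add, mul_add, smul_add, add_zero]; abel)
    (by
      intro c x y
      split_ifs <;>
        simp only [map_smul, mul_smul_comm, smul_add, map_add, add_zero,
          smul_comm c ((-1 : ℤ) ^ k)])

/-- `Pasc(I)` in dimension `k`: the quotient of `Ex(I)` by the unit, graded by
`dim (∧_{i ∈ P} e i) = card P - 1`. -/
abbrev Obj (I : Type) (k : ℕ) : Type := ⋀[ℤ]^(k + 1) (I →₀ ℤ)

theorem contract_mem {I : Type} (φ : (I →₀ ℤ) →ₗ[ℤ] ℤ) (n : ℕ) (x : Ex I)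
    (hx : x ∈ ⋀[ℤ]^(n + 1) (I →₀ ℤ)) : contract φ x ∈ ⋀[ℤ]^n (I →₀ ℤ) := by
  induction n generalizing x with
  | zero =>
    rw [ExteriorAlgebra.exteriorPower, zero_add, pow_one] at hx
    obtain ⟨v, rfl⟩ := hx
    rw [ExteriorAlgebra.exteriorPower, pow_zero, Submodule.mem_one]
    exact ⟨φ v, (CliffordAlgebra.contractLeft_ι _ φ v).symm⟩
  | succ n ih =>
    rw [ExteriorAlgebra.exteriorPower, pow_succ'] at hx
    induction hx using Submodule.mul_induction_on' with
    | mem_mul_mem a ha b hb =>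
      obtain ⟨v, rfl⟩ := ha
      have h : contract φ (ExteriorAlgebra.ι ℤ v * b) =
          φ v • b - ExteriorAlgebra.ι ℤ v * contract φ b :=
        CliffordAlgebra.contractLeft_ι_mul _ v b
      rw [h]
      refine Submodule.sub_mem _ (Submodule.smul_mem _ _ hb) ?_
      rw [ExteriorAlgebra.exteriorPower, pow_succ']
      exact Submodule.mul_mem_mul (LinearMap.mem_range_self _ _) (ih b hb)
    | add a _ b _ ha hb =>
      rw [map_add]
      exact Submodule.add_mem _ ha hb

theorem map_mem {M N : Type} [AddCommGroup M] [AddCommGroup N] (f : M →ₗ[ℤ] N) (n : ℕ)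
    (x : ExteriorAlgebra ℤ M) (hx : x ∈ ⋀[ℤ]^n M) : ExteriorAlgebra.map f x ∈ ⋀[ℤ]^n N := by
  have h : (⋀[ℤ]^n M).map (ExteriorAlgebra.map f).toLinearMap ≤ ⋀[ℤ]^n N := by
    rw [ExteriorAlgebra.exteriorPower, Submodule.map_pow]
    refine pow_le_pow_left' ?_ n
    rintro _ ⟨_, ⟨v, rfl⟩, rfl⟩
    exact ⟨f v, (ExteriorAlgebra.map_apply_ι f v).symm⟩
  exact h ⟨x, hx, rfl⟩

theorem mul_mem {M : Type} [AddCommGroup M] {a b c : ℕ} (h : a + b = c) {x y : ExteriorAlgebra ℤ M}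
    (hx : x ∈ ⋀[ℤ]^a M) (hy : y ∈ ⋀[ℤ]^b M) : x * y ∈ ⋀[ℤ]^c M := by
  subst h
  rw [ExteriorAlgebra.exteriorPower, pow_add]
  exact Submodule.mul_mem_mul hx hy

theorem e_mem {I : Type} (i : I) : e i ∈ ⋀[ℤ]^1 (I →₀ ℤ) := by
  rw [ExteriorAlgebra.exteriorPower, pow_one]
  exact LinearMap.mem_range_self _ _

theorem dEx_mem {I : Type} [Fintype I] (n : ℕ) (x : Ex I) (hx : x ∈ ⋀[ℤ]^(n + 1) (I →₀ ℤ)) :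
    dEx I x ∈ ⋀[ℤ]^n (I →₀ ℤ) := by
  rw [dEx, LinearMap.sum_apply]
  exact Submodule.sum_mem _ fun i _ => contract_mem _ n x hx

theorem compEx_mem {I J : Type} [Fintype J] {k l s : ℕ} (h : k + l = s) (i : I) (x : Ex I) (y : Ex J)
    (hx : x ∈ ⋀[ℤ]^(k + 1) (I →₀ ℤ)) (hy : y ∈ ⋀[ℤ]^(l + 1) (J →₀ ℤ)) :
    compEx k l i x y ∈ ⋀[ℤ]^(s + 1) (({a : I // a ≠ i} ⊕ J) →₀ ℤ) := by
  rw [compEx, LinearMap.mk₂_apply]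
  refine map_mem _ _ _ (Submodule.add_mem _ (Submodule.smul_mem _ _ ?_) ?_)
  · exact contract_mem _ _ _
      (mul_mem (a := k + 1) (b := l + 1) (by omega) (map_mem _ _ _ hx) (map_mem _ _ _ hy))
  · split_ifs with hl
    · subst hl
      exact mul_mem (a := k + 1) (b := 0) (by omega)
        (map_mem _ _ _ (contract_mem _ (k + 1) _
          (mul_mem (a := 1) (b := k + 1) (by omega) (e_mem i) hx)))
        (map_mem _ _ _ (dEx_mem 0 y hy))
    · exact Submodule.zero_mem _

end Pasc

/-- `compEx` on the graded pieces of `Pasc`. -/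
noncomputable def Pasc.comp {I J : Type} [Fintype J] {k l s : ℕ} (h : k + l = s) (i : I) :
    Pasc.Obj I k →+ Pasc.Obj J l →+ Pasc.Obj ({a : I // a ≠ i} ⊕ J) s :=
  AddMonoidHom.mk'
    (fun x => AddMonoidHom.mk'
      (fun y => ⟨Pasc.compEx k l i x.1 y.1, Pasc.compEx_mem h i x.1 y.1 x.2 y.2⟩)
      (fun y y' => Subtype.ext ((Pasc.compEx k l i x.1).map_add y.1 y'.1)))
    (fun x x' => AddMonoidHom.ext fun y =>
      Subtype.ext ((Pasc.compEx k l i).map_add₂ x.1 x'.1 y.1))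

/-- The differential graded symmetric operad `Pasc`. -/
noncomputable def Pasc : SymOperad where
  obj := Pasc.Obj
  relabel {_ _ k} σ :=
    ((Pasc.push σ).toLinearMap.restrict (fun x hx => Pasc.map_mem _ (k + 1) x hx)).toAddMonoidHom
  unit _ _ := ⟨Pasc.e default, Pasc.e_mem default⟩
  comp h i := Pasc.comp h i
  d I _ k :=
    ((Pasc.dEx I).restrict (p := ⋀[ℤ]^(k + 2) (I →₀ ℤ)) (q := ⋀[ℤ]^(k + 1) (I →₀ ℤ))
      (fun x hx => Pasc.dEx_mem (k + 1) x hx)).toAddMonoidHom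

/-! The module of relations of `Trias'` is the orthogonal of that of `K'` because a vector is
orthogonal to the seven relations of `K'` exactly if its 18 coordinates satisfy seven equations, and
these express it as an integral combination of the eleven relations of `Trias'` whose coefficients
are coordinates of the vector.

The axioms of `Pasc` are checked without bases. After identifying the inputs with `{1, …, r}` the
composite `x ∘ᵢ y` is `(-1) ^ k • σ (θ i x) * τ y`, to which `σ x * d y` is added if `y` has dimension
zero. Here `k = dim x`, and `σ`, `τ` are the algebra maps induced by the linear maps `outer` and
`inner`: `σ` kills `e i` and renumbers the other inputs of `x`, `τ` renumbers the inputs of `y`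
(`Pasc.toEx_comp`). Associativity, the parallel axiom and the Leibniz rule then follow from three
facts: contractions are antiderivations, they commute with algebra maps induced by linear maps up to
pulling back the functional, and exterior algebras are graded commutative.

The assignment of `e 1`, `e 2`, `e 2 ∧ e 1` to `⊣`, `⊢`, `×` respects the eleven relations, which gives
a morphism of operads `Pasc.comparison` from `Trias'` to `Pasc`. The relations rewrite every monomial
`a ∘₁ b` as a multiple of a monomial `a' ∘₂ b'`, and therefore `Trias'` is spanned by right combs
(`Trias.isComb`). The remaining relations `⊣ ∘₂ ⊢ = ⊣ ∘₂ ⊣` and `⊣ ∘₂ × = 0` show that `⊣ ∘₂ x` is a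
multiple of the comb built from `⊣` only. So an element of arity `n + 2` is `⊢ ∘₂ a + × ∘₂ b`, or
`⊢ ∘₂ a` plus a multiple of that comb in dimension zero (`Trias.splits`). On the side of `Pasc` the
operation `⊢ ∘₂ -` is the shift of the inputs, `× ∘₂ -` is minus the shift followed by the product with
the first basis vector, and the comb built from `⊣` is the first basis vector. Since each element of
the exterior algebra is uniquely of the form `a + e 1 ∧ b` with `a`, `b` not involving `e 1`, the
comparison is bijective by induction on the arity.

The differential of `Trias'` is transported from `Pasc`. It is determined by its values on the
generators because of the Leibniz rule. -/

/-! ### Quadratic duality -/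

open Gen3 in
theorem kData_dual_rel : kData.dual.rel = triasData.rel := by
  apply le_antisymm
  · intro v hv
    have key : ∀ u ∈ kData.rel, QuadData.pairing u v = 0 := hv
    have hsum : ∀ f : Gen3 × Gen3 → ℤ, ∑ p, f p =
        f (l, l) + f (l, r) + f (l, m) + (f (r, l) + f (r, r) + f (r, m)) +
          (f (m, l) + f (m, r) + f (m, m)) := by
      intro f
      rw [Fintype.sum_prod_type]
      simp [Finset.sum, Finset.univ, Fintype.elems]
      ring
    have h₁ := key (c₂ r l - c₁ l r) (Submodule.subset_span (by simp))
    have h₂ := key (c₂ r r - (c₁ r r + c₁ r l)) (Submodule.subset_span (by simp))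
    have h₃ := key (c₁ l l - (c₂ l l + c₂ l r)) (Submodule.subset_span (by simp))
    have h₄ := key (c₂ r m - c₁ m r) (Submodule.subset_span (by simp))
    have h₅ := key (c₁ l m - c₂ m l) (Submodule.subset_span (by simp))
    have h₆ := key (c₁ m l - c₂ m r) (Submodule.subset_span (by simp))
    have h₇ := key (c₁ m m + c₂ m m) (Submodule.subset_span (by simp))
    simp [QuadData.pairing, hsum, c₁, c₂, Pi.single_apply] at h₁ h₂ h₃ h₄ h₅ h₆ h₇
    -- The coordinates of `v` along the leading monomials of the eleven relations; the seven
    -- equations give the remaining coordinates.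
    have hv' : v = v (0, l, r) • (c₁ l r - c₂ r l) + v (1, l, l) • (c₂ l l - c₂ l r) +
        v (0, l, l) • (c₁ l l - c₂ l r) + v (0, r, r) • (c₁ r r - c₁ r l) +
        v (1, r, r) • (c₂ r r - c₁ r l) + v (0, m, r) • (c₁ m r - c₂ r m) +
        v (1, m, l) • (c₂ m l - c₁ l m) + v (0, m, l) • (c₁ m l - c₂ m r) +
        v (0, r, m) • c₁ r m + v (1, l, m) • c₂ l m + v (0, m, m) • (c₁ m m + c₂ m m) := by
      funext ⟨i, a, b⟩
      fin_cases i <;> cases a <;> cases b <;> simp [c₁, c₂] <;> linarith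
    rw [hv']
    refine Submodule.add_mem _ (Submodule.add_mem _ (Submodule.add_mem _ (Submodule.add_mem _
      (Submodule.add_mem _ (Submodule.add_mem _ (Submodule.add_mem _ (Submodule.add_mem _
      (Submodule.add_mem _ (Submodule.add_mem _ ?_ ?_) ?_) ?_) ?_) ?_) ?_) ?_) ?_) ?_) ?_
    all_goals exact Submodule.smul_mem _ _ (Submodule.subset_span (by simp))
  -- Each of the eleven relations is orthogonal to each of the seven; the argument passes through the
  -- orthogonal of a single relation in order to reduce to generators on both sides.
  · refine Submodule.span_le.2 ?_
    have swap : ∀ u v : Fin 2 × Gen3 × Gen3 → ℤ,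
        QuadData.pairing u v = QuadData.pairing v u := by
      intro u v
      simp only [QuadData.pairing, mul_comm]
    intro v hv
    have hle : kData.rel ≤ ({ deg := dim, rel := Submodule.span ℤ {v}, diff := fun _ _ => 0 } :
        QuadData Gen3).dual.rel := by
      refine Submodule.span_le.2 ?_
      intro u hu w hw
      obtain ⟨c, rfl⟩ := Submodule.mem_span_singleton.1 hw
      have : QuadData.pairing v u = 0 := by
        simp only [Set.mem_insert_iff, Set.mem_singleton_iff] at hu hv
        rcases hu with rfl | rfl | rfl | rfl | rfl | rfl | rfl <;>
        rcases hv with rfl | rfl | rfl | rfl | rfl | rfl | rfl | rfl | rfl | rfl | rfl <;>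
        decide
      have h₂ : QuadData.pairing (c • v) u = c * QuadData.pairing v u := by
        simp only [QuadData.pairing, Pi.smul_apply, smul_eq_mul, mul_sub, Finset.mul_sum, mul_assoc]
      rw [h₂, this, mul_zero]
    intro u hu
    rw [swap]
    exact hle hu v (Submodule.mem_span_singleton_self v)

theorem kData_dual : kData.dual = triasData := by
  refine QuadData.ext rfl kData_dual_rel ?_
  funext a b
  cases a <;> cases b <;> rfl

/-! ### Free operads and their quotients -/

namespace NSOperad

/-- The class of a formal expression in the free operad. -/
def FreeObj.mk {G : Type} {deg : G → ℕ} {n k : ℕ} (x : Expr deg n k) : FreeObj deg n k :=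
  Quot.mk _ x

theorem FreeObj.mk_signed {G : Type} {deg : G → ℕ} {n k : ℕ} (a : ℕ) (x : Expr deg n k) :
    FreeObj.mk (x.signed a) = (-1 : ℤ) ^ a • FreeObj.mk x := by
  unfold Expr.signed
  split_ifs with h
  · rw [h.neg_one_pow, one_zsmul]
  · rw [(Nat.not_even_iff_odd.1 h).neg_one_pow, neg_one_zsmul]
    rfl

theorem free_isOperad {G : Type} (deg : G → ℕ) : (free deg).IsOperad where
  unit_comp := by rintro n l ⟨y⟩; exact Quot.sound (.unit_comp y)
  comp_unit := by rintro m k i ⟨x⟩; exact Quot.sound (.comp_unit i x)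
  assoc := by
    rintro m n p r t u k l q s v w h₁ h₂ h₃ h₄ e₁ e₂ e₃ e₄ i j ⟨x⟩ ⟨y⟩ ⟨z⟩
    exact Quot.sound (.assoc h₁ h₂ h₃ h₄ e₁ e₂ e₃ e₄ i j x y z)
  parallel := by
    rintro m n p r t u k l q s v w h₁ h₂ h₃ h₄ e₁ e₂ e₃ e₄ i j hij ⟨x⟩ ⟨y⟩ ⟨z⟩
    exact (Quot.sound (.parallel h₁ h₂ h₃ h₄ e₁ e₂ e₃ e₄ i j hij x y z)).trans
      (FreeObj.mk_signed _ _)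

theorem quotient_isOperad {P : NSOperad} (hP : P.IsOperad) (S : ∀ n k : ℕ, Set (P.obj n k)) :
    (P.quotient S).IsOperad where
  unit_comp := by rintro n l ⟨y⟩; exact congrArg QuotientAddGroup.mk (hP.unit_comp y)
  comp_unit := by rintro m k i ⟨x⟩; exact congrArg QuotientAddGroup.mk (hP.comp_unit i x)
  assoc := by
    rintro m n p r t u k l q s v w h₁ h₂ h₃ h₄ e₁ e₂ e₃ e₄ i j ⟨x⟩ ⟨y⟩ ⟨z⟩
    exact congrArg QuotientAddGroup.mk (hP.assoc h₁ h₂ h₃ h₄ e₁ e₂ e₃ e₄ i j x y z)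
  parallel := by
    rintro m n p r t u k l q s v w h₁ h₂ h₃ h₄ e₁ e₂ e₃ e₄ i j hij ⟨x⟩ ⟨y⟩ ⟨z⟩
    exact congrArg QuotientAddGroup.mk (hP.parallel h₁ h₂ h₃ h₄ e₁ e₂ e₃ e₄ i j hij x y z)

/-- Morphisms of nonsymmetric graded operads. -/
structure Hom (P Q : NSOperad) where
  map : ∀ n k : ℕ, P.obj n k →+ Q.obj n k
  map_unit : map 1 0 P.unit = Q.unit
  map_comp : ∀ {m n r k l s : ℕ} (h : m + n = r + 1) (e : k + l = s) (i : Fin m)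
    (x : P.obj m k) (y : P.obj n l),
    map r s (P.comp h e i x y) = Q.comp h e i (map m k x) (map n l y)

/-- The value of a formal expression in an operad, given the values of the generators. -/
def Expr.eval {G : Type} {deg : G → ℕ} (Q : NSOperad)
    (f : ∀ (k : ℕ) (g : G), deg g = k → Q.obj 2 k) :
    ∀ {n k : ℕ}, Expr deg n k → Q.obj n k
  | _, _, .unit => Q.unit
  | _, k, .gen g hg => f k g hg
  | _, _, .zero => 0
  | _, _, .add x y => x.eval Q f + y.eval Q f
  | _, _, .neg x => - x.eval Q f
  | _, _, .comp h e i x y => Q.comp h e i (x.eval Q f) (y.eval Q f)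

theorem Expr.eval_signed {G : Type} {deg : G → ℕ} (Q : NSOperad)
    (f : ∀ (k : ℕ) (g : G), deg g = k → Q.obj 2 k) {n k : ℕ} (a : ℕ) (x : Expr deg n k) :
    (x.signed a).eval Q f = (-1 : ℤ) ^ a • x.eval Q f := by
  unfold Expr.signed
  split_ifs with h
  · rw [h.neg_one_pow, one_zsmul]
  · rw [(Nat.not_even_iff_odd.1 h).neg_one_pow, neg_one_zsmul, Expr.eval]

theorem Expr.eval_rel {G : Type} {deg : G → ℕ} {Q : NSOperad} (hQ : Q.IsOperad)
    (f : ∀ (k : ℕ) (g : G), deg g = k → Q.obj 2 k) {n k : ℕ} {x y : Expr deg n k}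
    (h : Expr.Rel x y) : x.eval Q f = y.eval Q f := by
  induction h with
  | refl => rfl
  | symm _ ih => exact ih.symm
  | trans _ _ ih ih' => exact ih.trans ih'
  | add_congr _ _ ih ih' => simp only [Expr.eval, ih, ih']
  | neg_congr _ ih => simp only [Expr.eval, ih]
  | comp_congr _ _ _ _ _ ih ih' => simp only [Expr.eval, ih, ih']
  | add_assoc => simp only [Expr.eval, _root_.add_assoc]
  | add_comm x y => simp only [Expr.eval, _root_.add_comm (x.eval Q f)]
  | zero_add => simp only [Expr.eval, _root_.zero_add]
  | neg_add => simp only [Expr.eval, neg_add_cancel]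
  | comp_add_left => simp only [Expr.eval, map_add, AddMonoidHom.add_apply]
  | comp_add_right => simp only [Expr.eval, map_add]
  | unit_comp => exact hQ.unit_comp _
  | comp_unit => exact hQ.comp_unit _ _
  | assoc => exact hQ.assoc _ _ _ _ _ _ _ _ _ _ _ _ _
  | parallel h₁ h₂ h₃ h₄ e₁ e₂ e₃ e₄ i j hij x y z =>
    rw [Expr.eval_signed]
    exact hQ.parallel h₁ h₂ h₃ h₄ e₁ e₂ e₃ e₄ i j hij _ _ _

/-- The universal property of the free operad. -/
def freeLift {G : Type} {deg : G → ℕ} {Q : NSOperad} (hQ : Q.IsOperad)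
    (f : ∀ (k : ℕ) (g : G), deg g = k → Q.obj 2 k) : Hom (free deg) Q where
  map n k := AddMonoidHom.mk' (Quot.lift (Expr.eval Q f) (fun _ _ h => Expr.eval_rel hQ f h))
    (by rintro ⟨x⟩ ⟨y⟩; rfl)
  map_unit := rfl
  map_comp := by rintro m n r k l s h e i ⟨x⟩ ⟨y⟩; rfl

theorem Hom.map_eq_zero_of_inIdeal {P Q : NSOperad} (φ : Hom P Q)
    {S : ∀ n k : ℕ, Set (P.obj n k)} (hS : ∀ n k, ∀ x ∈ S n k, φ.map n k x = 0) {n k : ℕ}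
    {x : P.obj n k} (hx : InIdeal P S x) : φ.map n k x = 0 := by
  induction hx with
  | of x hx => exact hS _ _ x hx
  | zero => exact map_zero _
  | add x y _ _ ih ih' => rw [map_add, ih, ih', add_zero]
  | neg x _ ih => rw [map_neg, ih, neg_zero]
  | comp_left h e i x y _ ih => rw [φ.map_comp, ih, map_zero, AddMonoidHom.zero_apply]
  | comp_right h e i x y _ ih => rw [φ.map_comp, ih, map_zero]

/-- The universal property of the quotient by an operadic ideal. -/
def quotientLift {P Q : NSOperad} (φ : Hom P Q) {S : ∀ n k : ℕ, Set (P.obj n k)}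
    (hS : ∀ n k, ∀ x ∈ S n k, φ.map n k x = 0) : Hom (P.quotient S) Q where
  map n k := QuotientAddGroup.lift (P.ideal S n k) (φ.map n k)
    (fun _ hx => φ.map_eq_zero_of_inIdeal hS hx)
  map_unit := φ.map_unit
  map_comp := by rintro m n r k l s h e i ⟨x⟩ ⟨y⟩; exact φ.map_comp h e i x y

end NSOperad

namespace QuadData

open NSOperad

theorem operad_isOperad {G : Type} [Fintype G] (Q : QuadData G) : Q.operad.IsOperad :=
  quotient_isOperad (free_isOperad Q.deg) _

/-- The elements of a presented operad are obtained from the unit and the generators by sums,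
opposites and compositions. -/
theorem operad_induction {G : Type} [Fintype G] (Q : QuadData G)
    {motive : ∀ n k : ℕ, Q.operad.obj n k → Prop}
    (unit : motive 1 0 Q.operad.unit)
    (gen : ∀ (k : ℕ) (g : G) (hg : Q.deg g = k), motive 2 k (Q.gen g hg))
    (zero : ∀ n k : ℕ, motive n k 0)
    (add : ∀ (n k : ℕ) (x y : Q.operad.obj n k), motive n k x → motive n k y → motive n k (x + y))
    (neg : ∀ (n k : ℕ) (x : Q.operad.obj n k), motive n k x → motive n k (-x))
    (comp : ∀ (m n r k l s : ℕ) (h : m + n = r + 1) (e : k + l = s) (i : Fin m)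
      (x : Q.operad.obj m k) (y : Q.operad.obj n l), motive m k x → motive n l y →
        motive r s (Q.operad.comp h e i x y))
    {n k : ℕ} (x : Q.operad.obj n k) : motive n k x := by
  suffices H : ∀ {n k : ℕ} (z : Expr Q.deg n k),
      motive n k (QuotientAddGroup.mk (FreeObj.mk z)) by
    obtain ⟨⟨z⟩⟩ := x
    exact H z
  intro n k z
  induction z with
  | unit => exact unit
  | gen g hg => exact gen _ g hg
  | zero => exact zero _ _
  | add x y ihx ihy => exact add _ _ _ _ ihx ihy
  | neg x ih => exact neg _ _ _ ih
  | comp h e i x y ihx ihy => exact comp _ _ _ _ _ _ h e i _ _ ihx ihy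

/-- The arity three component of dimension `k` of the free operad, as a linear function of the
coefficients on the monomials. -/
def elementHom {G : Type} [Fintype G] (deg : G → ℕ) (k : ℕ) :
    (Fin 2 × G × G → ℤ) →ₗ[ℤ] (free deg).obj 3 k :=
  (AddMonoidHom.mk' (fun v => element deg v k) (by
    intro v w
    simp only [element, ← Finset.sum_add_distrib]
    refine Finset.sum_congr rfl fun p _ => ?_
    split_ifs
    · rw [Pi.add_apply, add_smul]
    · rw [add_zero])).toIntLinearMap

theorem elementHom_single {G : Type} [Fintype G] [DecidableEq G] (deg : G → ℕ) (k : ℕ)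
    (p : Fin 2 × G × G) :
    elementHom deg k (Pi.single p 1) =
      if h : deg p.2.1 + deg p.2.2 = k then
        (free deg).comp (m := 2) (n := 2) rfl h p.1
          (freeGen deg p.2.1 rfl) (freeGen deg p.2.2 rfl)
      else 0 := by
  change element deg (Pi.single p 1) k = _
  rw [element, Finset.sum_eq_single p]
  · split_ifs
    · rw [Pi.single_eq_same, one_smul]
    · rfl
  · intro q _ hq
    split_ifs
    · rw [Pi.single_eq_of_ne hq, zero_smul]
    · rfl
  · simp

/-- The universal property of a presented operad. -/
def operadLift {G : Type} [Fintype G] (Q : QuadData G) {P : NSOperad} (hP : P.IsOperad)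
    (f : ∀ (k : ℕ) (g : G), Q.deg g = k → P.obj 2 k)
    (hf : ∀ k, Q.rel ≤ LinearMap.ker
      (((freeLift hP f).map 3 k).toIntLinearMap ∘ₗ elementHom Q.deg k)) :
    Hom Q.operad P :=
  quotientLift (freeLift hP f) (by
    intro n k x hx
    cases hx with
    | mk v hv => exact hf k hv)

/-- The projection from the arity three part of the free operad to the presented operad. -/
def operadElement {G : Type} [Fintype G] (Q : QuadData G) (k : ℕ) :
    (Fin 2 × G × G → ℤ) →ₗ[ℤ] Q.operad.obj 3 k :=
  (QuotientAddGroup.mk' ((free Q.deg).ideal (fun n k => {x | Relator Q n k x}) 3 k)).toIntLinearMap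
    ∘ₗ elementHom Q.deg k

theorem operadElement_eq_zero {G : Type} [Fintype G] (Q : QuadData G) (k : ℕ)
    {v : Fin 2 × G × G → ℤ} (hv : v ∈ Q.rel) : Q.operadElement k v = 0 :=
  (QuotientAddGroup.eq_zero_iff _).2 (InIdeal.of _ (Relator.mk v hv k))

theorem operadElement_single {G : Type} [Fintype G] [DecidableEq G] (Q : QuadData G) (k : ℕ)
    (p : Fin 2 × G × G) (h : Q.deg p.2.1 + Q.deg p.2.2 = k) :
    Q.operadElement k (Pi.single p 1) =
      Q.operad.comp (m := 2) (n := 2) rfl h p.1 (Q.gen p.2.1 rfl) (Q.gen p.2.2 rfl) := by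
  change QuotientAddGroup.mk (elementHom Q.deg k (Pi.single p 1)) = _
  rw [elementHom_single, dif_pos h]
  rfl

end QuadData

/-! ### Contractions of exterior algebras -/

namespace Pasc

section Contraction

variable {I J K : Type}

theorem contract_ι_mul (φ : (I →₀ ℤ) →ₗ[ℤ] ℤ) (v : I →₀ ℤ) (x : Ex I) :
    contract φ (ExteriorAlgebra.ι ℤ v * x) = φ v • x - ExteriorAlgebra.ι ℤ v * contract φ x :=
  CliffordAlgebra.contractLeft_ι_mul _ v x

theorem contract_ι (φ : (I →₀ ℤ) →ₗ[ℤ] ℤ) (v : I →₀ ℤ) :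
    contract φ (ExteriorAlgebra.ι ℤ v) = algebraMap ℤ (Ex I) (φ v) :=
  CliffordAlgebra.contractLeft_ι _ φ v

theorem contract_algebraMap (φ : (I →₀ ℤ) →ₗ[ℤ] ℤ) (c : ℤ) :
    contract φ (algebraMap ℤ (Ex I) c) = 0 :=
  CliffordAlgebra.contractLeft_algebraMap _ φ c

theorem contract_contract (φ : (I →₀ ℤ) →ₗ[ℤ] ℤ) (x : Ex I) : contract φ (contract φ x) = 0 :=
  CliffordAlgebra.contractLeft_contractLeft φ x

theorem contract_comm (φ ψ : (I →₀ ℤ) →ₗ[ℤ] ℤ) (x : Ex I) :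
    contract φ (contract ψ x) = -contract ψ (contract φ x) :=
  CliffordAlgebra.contractLeft_comm φ ψ x

theorem contract_zero (x : Ex I) : contract 0 x = 0 := by
  simp [contract]

theorem contract_sub (φ ψ : (I →₀ ℤ) →ₗ[ℤ] ℤ) (x : Ex I) :
    contract (φ - ψ) x = contract φ x - contract ψ x := by
  simp [contract]

theorem ex_induction {motive : Ex I → Prop} (x : Ex I)
    (scalar : ∀ c : ℤ, motive (algebraMap ℤ (Ex I) c))
    (add : ∀ x y, motive x → motive y → motive (x + y))
    (ι_mul : ∀ v x, motive x → motive (ExteriorAlgebra.ι ℤ v * x)) : motive x :=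
  CliffordAlgebra.left_induction (Q := (0 : QuadraticForm ℤ (I →₀ ℤ))) scalar add
    (fun x v hx => ι_mul v x hx) x

theorem contract_map (f : (I →₀ ℤ) →ₗ[ℤ] (J →₀ ℤ)) (φ : (J →₀ ℤ) →ₗ[ℤ] ℤ) (x : Ex I) :
    contract φ (ExteriorAlgebra.map f x) = ExteriorAlgebra.map f (contract (φ ∘ₗ f) x) := by
  induction x using ex_induction with
  | scalar c => rw [AlgHom.commutes, contract_algebraMap, contract_algebraMap, map_zero]
  | add x y hx hy => simp only [map_add, hx, hy]
  | ι_mul v x hx =>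
    rw [map_mul, ExteriorAlgebra.map_apply_ι, contract_ι_mul, contract_ι_mul, hx, map_sub, map_mul,
      ExteriorAlgebra.map_apply_ι, map_smul]
    rfl

theorem map_map (f : (I →₀ ℤ) →ₗ[ℤ] (J →₀ ℤ)) (g : (J →₀ ℤ) →ₗ[ℤ] (K →₀ ℤ)) (x : Ex I) :
    ExteriorAlgebra.map g (ExteriorAlgebra.map f x) = ExteriorAlgebra.map (g ∘ₗ f) x := by
  rw [← ExteriorAlgebra.map_comp_map]
  rfl

/-- Induction on elements of given degree of the exterior algebra. -/
theorem exteriorPower_induction {motive : ℕ → Ex I → Prop}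
    (scalar : ∀ c : ℤ, motive 0 (algebraMap ℤ (Ex I) c))
    (add : ∀ n x y, motive n x → motive n y → motive n (x + y))
    (ι_mul : ∀ n v x, x ∈ ⋀[ℤ]^n (I →₀ ℤ) → motive n x →
      motive (n + 1) (ExteriorAlgebra.ι ℤ v * x))
    {n : ℕ} {x : Ex I} (hx : x ∈ ⋀[ℤ]^n (I →₀ ℤ)) : motive n x := by
  induction n generalizing x with
  | zero =>
    rw [ExteriorAlgebra.exteriorPower, pow_zero, Submodule.mem_one] at hx
    obtain ⟨c, rfl⟩ := hx
    exact scalar c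
  | succ n ih =>
    rw [ExteriorAlgebra.exteriorPower, pow_succ'] at hx
    induction hx using Submodule.mul_induction_on' with
    | mem_mul_mem a ha b hb =>
      obtain ⟨v, rfl⟩ := ha
      exact ι_mul n v b hb (ih hb)
    | add a _ b _ ha hb => exact add _ _ _ ha hb

theorem exists_eq_algebraMap {x : Ex I} (hx : x ∈ ⋀[ℤ]^0 (I →₀ ℤ)) :
    ∃ c : ℤ, x = algebraMap ℤ (Ex I) c := by
  rw [ExteriorAlgebra.exteriorPower, pow_zero, Submodule.mem_one] at hx
  obtain ⟨c, rfl⟩ := hx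
  exact ⟨c, rfl⟩

/-- Contractions are antiderivations. -/
theorem contract_mul (φ : (I →₀ ℤ) →ₗ[ℤ] ℤ) {n : ℕ} {x : Ex I} (hx : x ∈ ⋀[ℤ]^n (I →₀ ℤ))
    (y : Ex I) :
    contract φ (x * y) = contract φ x * y + (-1 : ℤ) ^ n • (x * contract φ y) := by
  refine exteriorPower_induction (motive := fun n x =>
    contract φ (x * y) = contract φ x * y + (-1 : ℤ) ^ n • (x * contract φ y))
    (fun c => ?_) (fun n a b ha hb => ?_) (fun n v x _ ih => ?_) hx
  · rw [contract_algebraMap, zero_mul, zero_add, pow_zero, one_smul, ← Algebra.smul_def,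
      ← Algebra.smul_def, map_smul]
  · simp only [add_mul, map_add, ha, hb, smul_add]; abel
  · rw [mul_assoc, contract_ι_mul, contract_ι_mul, ih, pow_succ]
    simp only [mul_add, sub_mul, smul_mul_assoc, mul_smul_comm, mul_assoc, mul_neg, mul_one,
      neg_smul]
    abel

theorem ι_mul_ι_swap (v w : I →₀ ℤ) :
    ExteriorAlgebra.ι ℤ v * ExteriorAlgebra.ι ℤ w =
      -(ExteriorAlgebra.ι ℤ w * ExteriorAlgebra.ι ℤ v) :=
  eq_neg_of_add_eq_zero_left (ExteriorAlgebra.ι_add_mul_swap v w)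

theorem mul_ι_swap {n : ℕ} {x : Ex I} (hx : x ∈ ⋀[ℤ]^n (I →₀ ℤ)) (v : I →₀ ℤ) :
    x * ExteriorAlgebra.ι ℤ v = (-1 : ℤ) ^ n • (ExteriorAlgebra.ι ℤ v * x) := by
  refine exteriorPower_induction (motive := fun n x =>
    x * ExteriorAlgebra.ι ℤ v = (-1 : ℤ) ^ n • (ExteriorAlgebra.ι ℤ v * x))
    (fun c => ?_) (fun n a b ha hb => ?_) (fun n w x _ ih => ?_) hx
  · rw [pow_zero, one_smul, Algebra.commutes]
  · simp only [add_mul, mul_add, ha, hb, smul_add]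
  · rw [mul_assoc, ih, mul_smul_comm, ← mul_assoc, ι_mul_ι_swap, neg_mul, mul_assoc, pow_succ,
      smul_neg, mul_neg_one, neg_smul]

/-- Exterior algebras are graded commutative. -/
theorem mul_swap {a b : ℕ} {x y : Ex I} (hx : x ∈ ⋀[ℤ]^a (I →₀ ℤ)) (hy : y ∈ ⋀[ℤ]^b (I →₀ ℤ)) :
    x * y = (-1 : ℤ) ^ (a * b) • (y * x) := by
  refine exteriorPower_induction (motive := fun b y => x * y = (-1 : ℤ) ^ (a * b) • (y * x))
    (fun c => ?_) (fun n y z hy hz => ?_) (fun n v y _ ih => ?_) hy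
  · rw [mul_zero, pow_zero, one_smul, Algebra.commutes]
  · simp only [add_mul, mul_add, hy, hz, smul_add]
  · rw [← mul_assoc, mul_ι_swap hx, smul_mul_assoc, mul_assoc, ih, mul_smul_comm, smul_smul,
      mul_assoc, mul_add, mul_one, pow_add, mul_comm]

/-- The linear map which kills the basis vector `i` and fixes the other ones. -/
noncomputable def kill (i : I) : (I →₀ ℤ) →ₗ[ℤ] (I →₀ ℤ) :=
  LinearMap.id - (Finsupp.lapply i).smulRight (Finsupp.single i 1)

theorem kill_apply (i : I) (v : I →₀ ℤ) : kill i v = v - v i • Finsupp.single i 1 := rfl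

/-- Killing a basis vector removes the part of `x` divisible by it. -/
theorem map_kill (i : I) (x : Ex I) : ExteriorAlgebra.map (kill i) x = x - e i * θ i x := by
  induction x using ex_induction with
  | scalar c => rw [AlgHom.commutes, θ, contract_algebraMap, mul_zero, sub_zero]
  | add x y hx hy => simp only [map_add, hx, hy, mul_add]; abel
  | ι_mul v x hx =>
    have h₁ : e i * e i = 0 := ExteriorAlgebra.ι_sq_zero _
    have h₂ : e i * (ExteriorAlgebra.ι ℤ v * θ i x) = -(ExteriorAlgebra.ι ℤ v * (e i * θ i x)) := by
      rw [← mul_assoc, e, ι_mul_ι_swap, neg_mul, mul_assoc]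
    have h₃ : θ i (ExteriorAlgebra.ι ℤ v * x) = v i • x - ExteriorAlgebra.ι ℤ v * θ i x :=
      contract_ι_mul _ v x
    rw [map_mul, ExteriorAlgebra.map_apply_ι, hx, h₃, kill_apply, map_sub, map_smul]
    change (_ - v i • e i) * _ = _
    rw [sub_mul, mul_sub, mul_sub, mul_sub, h₂, mul_smul_comm, smul_mul_assoc, smul_mul_assoc,
      ← mul_assoc (e i) (e i), h₁, zero_mul, smul_zero]
    abel

/-- The sum of the coordinates; the differential is the contraction with this functional. -/
noncomputable def total (I : Type) [Fintype I] : (I →₀ ℤ) →ₗ[ℤ] ℤ := ∑ i : I, Finsupp.lapply i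

theorem dEx_apply [Fintype I] (x : Ex I) : dEx I x = contract (total I) x := by
  rw [dEx, LinearMap.sum_apply, total, contract, map_sum, LinearMap.sum_apply]
  rfl

theorem total_single [Fintype I] (i : I) (c : ℤ) : total I (Finsupp.single i c) = c := by
  classical
  simp [total, Finsupp.single_apply]

end Contraction

/-! ### Insertions of finite ordinals -/

section Insertion

/-- The basis vector with index `p`, and `0` if `p` is out of range. -/
noncomputable def δ (r p : ℕ) : Fin r →₀ ℤ := if hp : p < r then Finsupp.single ⟨p, hp⟩ 1 else 0

theorem single_eq_δ {r : ℕ} (a : Fin r) : Finsupp.single a 1 = δ r a := by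
  rw [δ, dif_pos a.2]

theorem δ_apply {r : ℕ} (p : ℕ) (a : Fin r) : δ r p a = if (a : ℕ) = p then 1 else 0 := by
  unfold δ
  split_ifs with h₁ h₂ h₂
  · rw [Finsupp.single_apply, if_pos (Fin.ext h₂.symm)]
  · rw [Finsupp.single_apply, if_neg (fun h => h₂ (congrArg Fin.val h).symm)]
  · omega
  · rfl

/-- Linear maps out of `Fin m →₀ ℤ` are determined on the vectors `δ m a` with `a < m`; this lets all
identities between renumberings be checked on natural numbers. -/
theorem hom_ext {m : ℕ} {M : Type} [AddCommGroup M] {f g : (Fin m →₀ ℤ) →ₗ[ℤ] M}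
    (h : ∀ a < m, f (δ m a) = g (δ m a)) : f = g := by
  ext a
  simp only [LinearMap.coe_comp, Function.comp_apply, Finsupp.lsingle_apply]
  rw [single_eq_δ]
  exact h a a.2

/-- The effect on the basis of `{1, …, m}` of the insertion of `n` inputs at the position `i`; the
basis vector `i` is killed. -/
noncomputable def outer {m n r : ℕ} (h : m + n = r + 1) (i : Fin m) :
    (Fin m →₀ ℤ) →ₗ[ℤ] (Fin r →₀ ℤ) :=
  Finsupp.linearCombination ℤ fun a =>
    if ha : a = i then 0 else Finsupp.single (insertFun m n r h i (.inl ⟨a, ha⟩)) 1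

/-- The inclusion of the basis of the `n` inputs inserted at the position `i`. -/
noncomputable def inner {m n r : ℕ} (h : m + n = r + 1) (i : Fin m) :
    (Fin n →₀ ℤ) →ₗ[ℤ] (Fin r →₀ ℤ) :=
  Finsupp.lmapDomain ℤ ℤ fun a => insertFun m n r h i (.inr a)

variable {m n r : ℕ} (h : m + n = r + 1) (i : Fin m)

theorem outer_δ (a : ℕ) (ha : a < m) :
    outer h i (δ m a) = if a = i then 0 else if a < i then δ r a else δ r (a + n - 1) := by
  rw [δ, dif_pos ha, outer, Finsupp.linearCombination_single, one_smul]
  by_cases h₁ : a = i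
  · rw [if_pos h₁, dif_pos (Fin.ext h₁)]
  · rw [if_neg h₁, dif_neg (fun h => h₁ (congrArg Fin.val h)), single_eq_δ]
    by_cases h₂ : a < i
    · rw [if_pos h₂]
      simp [insertFun, h₂]
    · rw [if_neg h₂]
      simp [insertFun, h₂]

theorem inner_δ (a : ℕ) (ha : a < n) : inner h i (δ n a) = δ r (i + a) := by
  rw [δ, dif_pos ha, inner, Finsupp.lmapDomain_apply, Finsupp.mapDomain_single, single_eq_δ]
  rfl

theorem total_comp_inner : total (Fin r) ∘ₗ inner h i = total (Fin n) := by
  ext a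
  simp [inner, total_single]

theorem total_comp_outer : total (Fin r) ∘ₗ outer h i = total (Fin m) - Finsupp.lapply i := by
  ext a
  by_cases ha : a = i
  · subst ha
    simp [outer, total_single]
  · simp [outer, total_single, ha]

theorem lapply_comp_inner (j : Fin n) (hj : (i : ℕ) + j < r) :
    Finsupp.lapply ⟨i + j, hj⟩ ∘ₗ inner h i = Finsupp.lapply (R := ℤ) (M := ℤ) j := by
  refine hom_ext fun a ha => ?_
  simp only [LinearMap.comp_apply, inner_δ h i a ha, Finsupp.lapply_apply, δ_apply]
  split_ifs <;> first | rfl | omega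

theorem lapply_comp_outer_self (j : ℕ) (hn : j < n) (hj : (i : ℕ) + j < r) :
    Finsupp.lapply ⟨i + j, hj⟩ ∘ₗ outer h i = (0 : (Fin m →₀ ℤ) →ₗ[ℤ] ℤ) := by
  refine hom_ext fun a ha => ?_
  simp only [LinearMap.comp_apply, outer_δ h i a ha, Finsupp.lapply_apply, LinearMap.zero_apply]
  split_ifs <;> simp only [δ_apply, Finsupp.coe_zero, Pi.zero_apply] <;> split_ifs <;>
    first | rfl | omega

variable {p t u : ℕ} (h₂ : r + p = t + 1)

theorem outer_comp_outer_inner (h₃ : n + p = u + 1) (h₄ : m + u = t + 1) (j : Fin n)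
    (hj : (i : ℕ) + j < r) : outer h₂ ⟨i + j, hj⟩ ∘ₗ outer h i = outer h₄ i := by
  refine hom_ext fun a ha => ?_
  rw [LinearMap.comp_apply, outer_δ h i a ha, outer_δ h₄ i a ha]
  have := j.2
  split_ifs
  · exact map_zero _
  · rw [outer_δ _ _ _ (by omega)]
    simp only
    split_ifs <;> first | rfl | omega
  · rw [outer_δ _ _ _ (by omega)]
    simp only
    split_ifs <;> first | omega | (congr 1; omega)

theorem outer_comp_inner (h₃ : n + p = u + 1) (h₄ : m + u = t + 1) (j : Fin n)
    (hj : (i : ℕ) + j < r) : outer h₂ ⟨i + j, hj⟩ ∘ₗ inner h i = inner h₄ i ∘ₗ outer h₃ j := by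
  refine hom_ext fun a ha => ?_
  rw [LinearMap.comp_apply, LinearMap.comp_apply, inner_δ h i a ha, outer_δ _ _ _ (by omega),
    outer_δ _ _ _ ha]
  simp only [add_right_inj, add_lt_add_iff_left]
  split_ifs
  · exact (map_zero _).symm
  · rw [inner_δ _ _ _ (by omega)]
  · rw [inner_δ _ _ _ (by omega)]
    congr 1; omega

theorem inner_comp_inner (h₃ : n + p = u + 1) (h₄ : m + u = t + 1) (j : Fin n)
    (hj : (i : ℕ) + j < r) : inner h₄ i ∘ₗ inner h₃ j = inner h₂ ⟨i + j, hj⟩ := by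
  refine hom_ext fun a ha => ?_
  rw [LinearMap.comp_apply, inner_δ _ _ _ ha, inner_δ _ _ _ (by omega), inner_δ _ _ _ ha]
  congr 1; simp only; omega

section Parallel

variable {i} {j : Fin m} (hij : (i : ℕ) < j) (h₃ : m + p = u + 1) (h₄ : u + n = t + 1)
include hij

theorem outer_comp_outer_parallel (hj : (j : ℕ) + n - 1 < r) (hi : (i : ℕ) < u) :
    outer h₂ ⟨j + n - 1, hj⟩ ∘ₗ outer h i = outer h₄ ⟨i, hi⟩ ∘ₗ outer h₃ j := by
  refine hom_ext fun a ha => ?_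
  rw [LinearMap.comp_apply, LinearMap.comp_apply, outer_δ h i a ha, outer_δ h₃ j a ha]
  split_ifs
  · omega
  · rw [outer_δ _ _ _ (by omega), map_zero]
    simp only
    split_ifs
    rfl
  · rw [outer_δ _ _ _ (by omega), map_zero]
    simp only
    split_ifs <;> first | rfl | omega
  all_goals
    first
    | (exfalso; omega)
    | (try rw [map_zero]
       repeat rw [outer_δ _ _ _ (by omega)]
       simp only
       split_ifs <;> first | rfl | omega | (congr 1; omega))

theorem outer_comp_inner_parallel (hj : (j : ℕ) + n - 1 < r) (hi : (i : ℕ) < u) :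
    outer h₂ ⟨j + n - 1, hj⟩ ∘ₗ inner h i = inner h₄ ⟨i, hi⟩ := by
  refine hom_ext fun a ha => ?_
  rw [LinearMap.comp_apply, inner_δ h i a ha, outer_δ _ _ _ (by omega), inner_δ _ _ _ ha]
  simp only
  split_ifs <;> first | rfl | omega

theorem outer_comp_inner_parallel' (hj : (j : ℕ) + n - 1 < r) (hi : (i : ℕ) < u) :
    outer h₄ ⟨i, hi⟩ ∘ₗ inner h₃ j = inner h₂ ⟨j + n - 1, hj⟩ := by
  refine hom_ext fun a ha => ?_
  rw [LinearMap.comp_apply, inner_δ _ _ a ha, outer_δ _ _ _ (by omega), inner_δ _ _ _ ha]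
  simp only
  split_ifs <;> first | omega | (congr 1; omega)

theorem lapply_comp_outer_right (hj : (j : ℕ) + n - 1 < r) :
    Finsupp.lapply ⟨j + n - 1, hj⟩ ∘ₗ outer h i = Finsupp.lapply (R := ℤ) (M := ℤ) j := by
  refine hom_ext fun a ha => ?_
  simp only [LinearMap.comp_apply, outer_δ h i a ha, Finsupp.lapply_apply]
  split_ifs <;> simp only [δ_apply, Finsupp.coe_zero, Pi.zero_apply] <;> split_ifs <;>
    first | rfl | omega

theorem lapply_comp_inner_right (hj : (j : ℕ) + n - 1 < r) :
    Finsupp.lapply ⟨j + n - 1, hj⟩ ∘ₗ inner h i = (0 : (Fin n →₀ ℤ) →ₗ[ℤ] ℤ) := by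
  refine hom_ext fun a ha => ?_
  simp only [LinearMap.comp_apply, inner_δ h i a ha, Finsupp.lapply_apply, δ_apply,
    LinearMap.zero_apply]
  split_ifs <;> first | rfl | omega

theorem lapply_comp_outer_left (hi : (i : ℕ) < u) :
    Finsupp.lapply ⟨i, hi⟩ ∘ₗ outer h₃ j = Finsupp.lapply (R := ℤ) (M := ℤ) i := by
  refine hom_ext fun a ha => ?_
  simp only [LinearMap.comp_apply, outer_δ h₃ j a ha, Finsupp.lapply_apply]
  split_ifs <;> simp only [δ_apply, Finsupp.coe_zero, Pi.zero_apply] <;> split_ifs <;>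
    first | rfl | omega

theorem lapply_comp_inner_left (hi : (i : ℕ) < u) :
    Finsupp.lapply ⟨i, hi⟩ ∘ₗ inner h₃ j = (0 : (Fin p →₀ ℤ) →ₗ[ℤ] ℤ) := by
  refine hom_ext fun a ha => ?_
  simp only [LinearMap.comp_apply, inner_δ h₃ j a ha, Finsupp.lapply_apply, δ_apply,
    LinearMap.zero_apply]
  split_ifs <;> first | rfl | omega

end Parallel

end Insertion

end Pasc

/-! ### The operad `Pasc` -/

namespace Pasc

/-- The composition of `Pasc` in terms of the order of the inputs: the vector `e i` is contracted
away and replaced by the second argument, and the terms of the first argument without `e i`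
survive if the second argument has dimension zero. -/
noncomputable def ins {m n r : ℕ} (h : m + n = r + 1) (k l : ℕ) (i : Fin m) (x : Ex (Fin m))
    (y : Ex (Fin n)) : Ex (Fin r) :=
  (-1 : ℤ) ^ k • (ExteriorAlgebra.map (outer h i) (θ i x) * ExteriorAlgebra.map (inner h i) y) +
    if l = 0 then ExteriorAlgebra.map (outer h i) x * ExteriorAlgebra.map (inner h i) (dEx _ y)
    else 0

/-- The inclusion of the components of `Pasc` in exterior algebras. -/
noncomputable def toEx {n k : ℕ} : Pasc.forget.obj n k →+ Ex (Fin n) :=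
  (⋀[ℤ]^(k + 1) (Fin n →₀ ℤ)).subtype.toAddMonoidHom

theorem toEx_injective {n k : ℕ} : Function.Injective (toEx : Pasc.forget.obj n k →+ Ex (Fin n)) :=
  Subtype.val_injective

theorem toEx_mem {n k : ℕ} (x : Pasc.forget.obj n k) : toEx x ∈ ⋀[ℤ]^(k + 1) (Fin n →₀ ℤ) :=
  Subtype.property (p := fun y => y ∈ ⋀[ℤ]^(k + 1) (Fin n →₀ ℤ)) x

theorem toEx_unit : toEx Pasc.forget.unit = e (0 : Fin 1) := rfl

theorem toEx_forgetD {n k : ℕ} (x : Pasc.forget.obj n (k + 1)) :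
    toEx (Pasc.forgetD n k x) = dEx (Fin n) (toEx x) := rfl

theorem map_outer_e {m n r : ℕ} (h : m + n = r + 1) (i : Fin m) :
    ExteriorAlgebra.map (outer h i) (e i) = 0 := by
  rw [e, ExteriorAlgebra.map_apply_ι]
  simp [outer]

theorem toEx_comp {m n r k l s : ℕ} (h : m + n = r + 1) (e : k + l = s) (i : Fin m)
    (x : Pasc.forget.obj m k) (y : Pasc.forget.obj n l) :
    toEx (Pasc.forget.comp h e i x y) = ins h k l i (toEx x) (toEx y) := by
  set X := toEx x with hX
  set Y := toEx y with hY
  have hXm : X ∈ ⋀[ℤ]^(k + 1) (Fin m →₀ ℤ) := toEx_mem x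
  change push (insertEquiv h i) (compEx k l i X Y) = _
  -- Renumbering the inputs turns the restriction, which kills `e i`, into `outer` and `inner`.
  have hΦ : ∀ z, push (insertEquiv h i) (restrict (Fin n) i (push Sum.inl z)) =
      ExteriorAlgebra.map (outer h i) z := by
    intro z
    simp only [push, restrict, map_map]
    congr 2
    ext a b
    simp only [LinearMap.coe_comp, Function.comp_apply, Finsupp.lsingle_apply,
      Finsupp.lmapDomain_apply, Finsupp.mapDomain_single]
    by_cases ha : a = i
    · subst ha
      have : Finsupp.lcomapDomain (M := ℤ) (R := ℤ) _ (inclusion_injective (Fin m) (Fin n) a)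
          (Finsupp.single (Sum.inl a) 1) = 0 := by
        ext c
        rcases c with ⟨c, hc⟩ | c
        · simp [Finsupp.lcomapDomain]
        · simp [Finsupp.lcomapDomain]
      rw [this]
      simp [outer]
    · have : Finsupp.lcomapDomain (M := ℤ) (R := ℤ) _ (inclusion_injective (Fin m) (Fin n) i)
          (Finsupp.single (Sum.inl a) 1) = Finsupp.single (Sum.inl ⟨a, ha⟩) 1 := by
        ext c
        rcases c with ⟨c, hc⟩ | c
        · simp [Finsupp.lcomapDomain, Finsupp.single_apply]
        · simp [Finsupp.lcomapDomain]
      rw [this]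
      simp [outer, ha, insertEquiv]
  have hΨ : ∀ z, push (insertEquiv h i) (restrict (Fin n) i (push Sum.inr z)) =
      ExteriorAlgebra.map (inner h i) z := by
    intro z
    simp only [push, restrict, map_map]
    congr 2
    ext a b
    simp only [LinearMap.coe_comp, Function.comp_apply, Finsupp.lsingle_apply,
      Finsupp.lmapDomain_apply, Finsupp.mapDomain_single]
    have : Finsupp.lcomapDomain (M := ℤ) (R := ℤ) _ (inclusion_injective (Fin m) (Fin n) i)
        (Finsupp.single (Sum.inr a) 1) = Finsupp.single (Sum.inr a) 1 := by
      ext c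
      rcases c with ⟨c, hc⟩ | c
      · simp [Finsupp.lcomapDomain]
      · simp [Finsupp.lcomapDomain, Finsupp.single_apply]
    rw [this]
    simp [inner, insertEquiv]
  have h₁ : θ (Sum.inl i) (push Sum.inl X * push (Sum.inr : Fin n → Fin m ⊕ Fin n) Y) =
      push Sum.inl (θ i X) * push Sum.inr Y := by
    have hX' : push (Sum.inl : Fin m → Fin m ⊕ Fin n) X ∈ ⋀[ℤ]^(k + 1) (Fin m ⊕ Fin n →₀ ℤ) :=
      map_mem _ _ _ hXm
    rw [θ, contract_mul _ hX']
    have hl : contract (Finsupp.lapply (Sum.inl i)) (push (Sum.inl : Fin m → Fin m ⊕ Fin n) X) =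
        push Sum.inl (θ i X) := by
      have : Finsupp.lapply (Sum.inl i) ∘ₗ
          Finsupp.lmapDomain ℤ ℤ (Sum.inl : Fin m → Fin m ⊕ Fin n) = Finsupp.lapply i := by
        ext a
        simp [Finsupp.single_apply]
      rw [push, contract_map, this, θ]
    have hr : contract (Finsupp.lapply (Sum.inl i)) (push (Sum.inr : Fin n → Fin m ⊕ Fin n) Y) =
        0 := by
      rw [push, contract_map]
      have : Finsupp.lapply (Sum.inl i) ∘ₗ
          Finsupp.lmapDomain ℤ ℤ (Sum.inr : Fin n → Fin m ⊕ Fin n) = (0 : _ →ₗ[ℤ] ℤ) := by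
        ext a
        simp
      rw [this, contract_zero, map_zero]
    rw [hl, hr, mul_zero, smul_zero, add_zero]
  have h₂ : θ i (Pasc.e i * X) = X - Pasc.e i * θ i X := by
    rw [θ, Pasc.e, contract_ι_mul]
    simp
  rw [compEx, LinearMap.mk₂_apply, h₁, ins]
  simp only [map_add, map_smul, map_mul, hΦ, hΨ, apply_ite (restrict (Fin n) i),
    apply_ite (push (insertEquiv h i)), h₂, map_sub, map_outer_e, zero_mul, sub_zero, map_zero]

section Ins

variable {m n r p t u : ℕ} (h₁ : m + n = r + 1) (h₂ : r + p = t + 1)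
variable {k l q : ℕ} (i : Fin m) {x : Ex (Fin m)} {y : Ex (Fin n)} {z : Ex (Fin p)}

theorem mul_algebraMap {I : Type} (x : Ex I) (c : ℤ) : x * algebraMap ℤ (Ex I) c = c • x := by
  rw [← Algebra.commutes, ← Algebra.smul_def]

theorem algebraMap_mul {I : Type} (x : Ex I) (c : ℤ) : algebraMap ℤ (Ex I) c * x = c • x :=
  (Algebra.smul_def c x).symm

theorem dEx_dEx {I : Type} [Fintype I] (x : Ex I) : dEx I (dEx I x) = 0 := by
  rw [dEx_apply, dEx_apply, contract_contract]

theorem exists_dEx_eq {I : Type} [Fintype I] {x : Ex I} (hx : x ∈ ⋀[ℤ]^(0 + 1) (I →₀ ℤ)) :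
    ∃ c : ℤ, dEx I x = algebraMap ℤ (Ex I) c :=
  exists_eq_algebraMap (dEx_mem 0 x hx)

theorem map_outer_θ_mem (hx : x ∈ ⋀[ℤ]^(k + 1) (Fin m →₀ ℤ)) :
    ExteriorAlgebra.map (outer h₁ i) (θ i x) ∈ ⋀[ℤ]^k (Fin r →₀ ℤ) :=
  map_mem _ _ _ (contract_mem _ _ _ hx)

theorem ins_zero (c : ℤ) (hc : dEx (Fin n) y = algebraMap ℤ _ c) :
    ins h₁ k 0 i x y = (-1 : ℤ) ^ k • (ExteriorAlgebra.map (outer h₁ i) (θ i x) *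
      ExteriorAlgebra.map (inner h₁ i) y) + c • ExteriorAlgebra.map (outer h₁ i) x := by
  rw [ins, if_pos rfl, hc, AlgHom.commutes, mul_algebraMap]

theorem ins_succ :
    ins h₁ k (l + 1) i x y = (-1 : ℤ) ^ k • (ExteriorAlgebra.map (outer h₁ i) (θ i x) *
      ExteriorAlgebra.map (inner h₁ i) y) := by
  rw [ins, if_neg (Nat.succ_ne_zero l), add_zero]

theorem θ_map_outer_self (x : Ex (Fin m)) (j : Fin n) (hj : (i : ℕ) + j < r) :
    θ ⟨i + j, hj⟩ (ExteriorAlgebra.map (outer h₁ i) x) = 0 := by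
  rw [θ, contract_map, lapply_comp_outer_self h₁ i j j.2, contract_zero, map_zero]

/-- The contraction of a composite at one of the inputs of the second argument. -/
theorem θ_ins_inner (hx : x ∈ ⋀[ℤ]^(k + 1) (Fin m →₀ ℤ)) (hy : y ∈ ⋀[ℤ]^(l + 1) (Fin n →₀ ℤ))
    (j : Fin n) (hj : (i : ℕ) + j < r) :
    θ ⟨i + j, hj⟩ (ins h₁ k l i x y) = ExteriorAlgebra.map (outer h₁ i) (θ i x) *
      ExteriorAlgebra.map (inner h₁ i) (θ j y) := by
  have key : θ ⟨i + j, hj⟩ ((-1 : ℤ) ^ k • (ExteriorAlgebra.map (outer h₁ i) (θ i x) *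
      ExteriorAlgebra.map (inner h₁ i) y)) = ExteriorAlgebra.map (outer h₁ i) (θ i x) *
      ExteriorAlgebra.map (inner h₁ i) (θ j y) := by
    rw [map_smul, θ, contract_mul _ (map_outer_θ_mem h₁ i hx), contract_map, contract_map,
      lapply_comp_outer_self h₁ i j j.2, lapply_comp_inner, contract_zero, map_zero, zero_mul,
      zero_add, smul_smul, ← mul_pow]
    simp [θ]
  cases l with
  | zero =>
    obtain ⟨c, hc⟩ := exists_dEx_eq hy
    rw [ins_zero h₁ i c hc, map_add, key, map_smul, θ_map_outer_self, smul_zero, add_zero]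
  | succ l => rw [ins_succ, key]

theorem dEx_map_inner (y : Ex (Fin n)) :
    dEx (Fin r) (ExteriorAlgebra.map (inner h₁ i) y) =
      ExteriorAlgebra.map (inner h₁ i) (dEx (Fin n) y) := by
  rw [dEx_apply, dEx_apply, contract_map, total_comp_inner]

theorem dEx_map_outer (x : Ex (Fin m)) :
    dEx (Fin r) (ExteriorAlgebra.map (outer h₁ i) x) =
      ExteriorAlgebra.map (outer h₁ i) (dEx (Fin m) x) -
        ExteriorAlgebra.map (outer h₁ i) (θ i x) := by
  rw [dEx_apply, dEx_apply, contract_map, total_comp_outer, contract_sub, map_sub]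
  rfl

theorem dEx_θ (x : Ex (Fin m)) : dEx (Fin m) (θ i x) = -θ i (dEx (Fin m) x) := by
  rw [dEx_apply, dEx_apply, θ, contract_comm]

theorem dEx_map_outer_θ (x : Ex (Fin m)) :
    dEx (Fin r) (ExteriorAlgebra.map (outer h₁ i) (θ i x)) =
      -ExteriorAlgebra.map (outer h₁ i) (θ i (dEx (Fin m) x)) := by
  rw [dEx_map_outer, dEx_θ, θ, contract_contract, map_zero, sub_zero, map_neg]

theorem dEx_mul {I : Type} [Fintype I] {k : ℕ} {x : Ex I} (hx : x ∈ ⋀[ℤ]^k (I →₀ ℤ)) (y : Ex I) :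
    dEx I (x * y) = dEx I x * y + (-1 : ℤ) ^ k • (x * dEx I y) := by
  simp only [dEx_apply, contract_mul _ hx]

theorem neg_one_pow_mul_self (k : ℕ) : (-1 : ℤ) ^ k * (-1) ^ k = 1 := by
  rw [← mul_pow]
  simp

theorem dEx_ins_succ_succ (hx : x ∈ ⋀[ℤ]^(k + 2) (Fin m →₀ ℤ)) :
    dEx (Fin r) (ins h₁ (k + 1) (l + 1) i x y) =
      ins h₁ k (l + 1) i (dEx _ x) y + (-1 : ℤ) ^ (k + 1) • ins h₁ (k + 1) l i x (dEx _ y) := by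
  have key : ins h₁ (k + 1) l i x (dEx _ y) = (-1 : ℤ) ^ (k + 1) •
      (ExteriorAlgebra.map (outer h₁ i) (θ i x) *
        ExteriorAlgebra.map (inner h₁ i) (dEx (Fin n) y)) := by
    rw [ins, dEx_dEx, map_zero, mul_zero, ite_self, add_zero]
  rw [key, ins_succ, ins_succ, map_smul, dEx_mul (map_outer_θ_mem h₁ i hx), dEx_map_inner,
    dEx_map_outer_θ, neg_mul, pow_succ]
  module

theorem dEx_ins_succ_zero (hx : x ∈ ⋀[ℤ]^(k + 2) (Fin m →₀ ℤ))
    (hy : y ∈ ⋀[ℤ]^(0 + 1) (Fin n →₀ ℤ)) :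
    dEx (Fin r) (ins h₁ (k + 1) 0 i x y) = ins h₁ k 0 i (dEx _ x) y := by
  obtain ⟨c, hc⟩ := exists_dEx_eq hy
  rw [ins_zero h₁ i c hc, ins_zero h₁ i c hc, map_add, map_smul, map_smul,
    dEx_mul (map_outer_θ_mem h₁ i hx), dEx_map_inner, dEx_map_outer_θ, dEx_map_outer, hc,
    AlgHom.commutes, mul_algebraMap, neg_mul, smul_add, smul_smul, neg_one_pow_mul_self, pow_succ]
  module

theorem dEx_ins_zero_succ (hx : x ∈ ⋀[ℤ]^(0 + 1) (Fin m →₀ ℤ)) :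
    dEx (Fin r) (ins h₁ 0 (l + 1) i x y) = ins h₁ 0 l i x (dEx _ y) := by
  obtain ⟨c, hc⟩ := exists_eq_algebraMap (contract_mem (Finsupp.lapply i) 0 x hx)
  rw [ins_succ, ins, dEx_dEx, map_zero, mul_zero, ite_self, add_zero, θ, hc, AlgHom.commutes,
    algebraMap_mul, algebraMap_mul, map_smul, map_smul, dEx_map_inner]

/-- The augmentation is multiplicative in dimension zero. -/
theorem dEx_ins_zero_zero {c d : ℤ} (hx : x ∈ ⋀[ℤ]^(0 + 1) (Fin m →₀ ℤ))
    (hc : dEx (Fin m) x = algebraMap ℤ _ c) (hd : dEx (Fin n) y = algebraMap ℤ _ d) :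
    dEx (Fin r) (ins h₁ 0 0 i x y) = algebraMap ℤ _ (c * d) := by
  obtain ⟨a, ha⟩ := exists_eq_algebraMap (contract_mem (Finsupp.lapply i) 0 x hx)
  have ha' : θ i x = algebraMap ℤ _ a := ha
  rw [ins_zero h₁ i d hd, ha', map_add, map_smul, map_smul, AlgHom.commutes, algebraMap_mul,
    map_smul, dEx_map_inner, dEx_map_outer, hc, hd, ha', AlgHom.commutes, AlgHom.commutes,
    AlgHom.commutes, Algebra.algebraMap_eq_smul_one, Algebra.algebraMap_eq_smul_one,
    Algebra.algebraMap_eq_smul_one, Algebra.algebraMap_eq_smul_one]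
  module

theorem ins_assoc (h₃ : n + p = u + 1) (h₄ : m + u = t + 1) (j : Fin n) (hj : (i : ℕ) + j < r)
    (hx : x ∈ ⋀[ℤ]^(k + 1) (Fin m →₀ ℤ)) (hy : y ∈ ⋀[ℤ]^(l + 1) (Fin n →₀ ℤ))
    (hz : z ∈ ⋀[ℤ]^(q + 1) (Fin p →₀ ℤ)) :
    ins h₂ (k + l) q ⟨i + j, hj⟩ (ins h₁ k l i x y) z =
      ins h₄ k (l + q) i x (ins h₃ l q j y z) := by
  have h₅ := outer_comp_outer_inner h₁ i h₂ h₃ h₄ j hj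
  have h₆ := outer_comp_inner h₁ i h₂ h₃ h₄ j hj
  have h₇ := inner_comp_inner i h₂ h₃ h₄ j hj
  have hθ := θ_ins_inner h₁ i hx hy j hj
  rcases q with _ | q
  · obtain ⟨d, hd⟩ := exists_dEx_eq hz
    rcases l with _ | l
    · obtain ⟨c, hc⟩ := exists_dEx_eq hy
      have hcd := dEx_ins_zero_zero h₃ j hy hc hd
      rw [ins_zero h₂ _ d hd, hθ, ins_zero h₄ i _ hcd, ins_zero h₁ i c hc, ins_zero h₃ j d hd]
      simp only [map_add, map_smul, map_mul, map_map, h₅, h₆, h₇, mul_add, mul_smul_comm, mul_assoc]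
      module
    · rw [ins_zero h₂ _ d hd, hθ, ins_succ h₁ i, Nat.add_zero, ins_succ h₄ i, ins_zero h₃ j d hd]
      simp only [map_add, map_smul, map_mul, map_map, h₅, h₆, h₇, mul_add, mul_smul_comm, mul_assoc]
      module
  · rw [ins_succ h₂, hθ, ← Nat.add_assoc, ins_succ h₄, ins_succ h₃]
    simp only [map_smul, map_mul, map_map, h₅, h₆, h₇, mul_smul_comm, mul_assoc]
    module

/-- The contraction of a composite at an input to the right of the composition. -/
theorem θ_ins_right {j : Fin m} (hij : (i : ℕ) < j) (hj : (j : ℕ) + n - 1 < r)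
    (hx : x ∈ ⋀[ℤ]^(k + 1) (Fin m →₀ ℤ)) :
    θ ⟨j + n - 1, hj⟩ (ins h₁ k l i x y) =
      -(-1 : ℤ) ^ k • (ExteriorAlgebra.map (outer h₁ i) (θ i (θ j x)) *
        ExteriorAlgebra.map (inner h₁ i) y) +
      if l = 0 then ExteriorAlgebra.map (outer h₁ i) (θ j x) *
        ExteriorAlgebra.map (inner h₁ i) (dEx _ y) else 0 := by
  have hy : ∀ y : Ex (Fin n), θ ⟨j + n - 1, hj⟩ (ExteriorAlgebra.map (inner h₁ i) y) = 0 := by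
    intro y
    rw [θ, contract_map, lapply_comp_inner_right h₁ hij, contract_zero, map_zero]
  have hx' : ∀ x : Ex (Fin m), θ ⟨j + n - 1, hj⟩ (ExteriorAlgebra.map (outer h₁ i) x) =
      ExteriorAlgebra.map (outer h₁ i) (θ j x) := by
    intro x
    rw [θ, contract_map, lapply_comp_outer_right h₁ hij]
    rfl
  have hmul : ∀ {a : ℕ} {x : Ex (Fin r)}, x ∈ ⋀[ℤ]^a (Fin r →₀ ℤ) → ∀ y : Ex (Fin n),
      θ ⟨j + n - 1, hj⟩ (x * ExteriorAlgebra.map (inner h₁ i) y) =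
        θ ⟨j + n - 1, hj⟩ x * ExteriorAlgebra.map (inner h₁ i) y := by
    intro a x hx y
    have := hy y
    rw [θ] at this ⊢
    rw [contract_mul _ hx, this, mul_zero, smul_zero, add_zero]
  have hcomm : θ j (θ i x) = -θ i (θ j x) := contract_comm _ _ _
  rw [ins, map_add, map_smul, hmul (map_outer_θ_mem h₁ i hx), hx', hcomm, map_neg,
    apply_ite (θ _), hmul (map_mem _ _ _ hx), hx', map_zero, neg_mul, smul_neg, neg_smul]

/-- The contraction of a composite at an input to the left of the composition. -/
theorem θ_ins_left (h₃ : m + p = u + 1) {j : Fin m} (hij : (i : ℕ) < j) (hi : (i : ℕ) < u)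
    (hx : x ∈ ⋀[ℤ]^(k + 1) (Fin m →₀ ℤ)) :
    θ ⟨i, hi⟩ (ins h₃ k q j x z) =
      (-1 : ℤ) ^ k • (ExteriorAlgebra.map (outer h₃ j) (θ i (θ j x)) *
        ExteriorAlgebra.map (inner h₃ j) z) +
      if q = 0 then ExteriorAlgebra.map (outer h₃ j) (θ i x) *
        ExteriorAlgebra.map (inner h₃ j) (dEx _ z) else 0 := by
  have hz : ∀ z : Ex (Fin p), θ ⟨i, hi⟩ (ExteriorAlgebra.map (inner h₃ j) z) = 0 := by
    intro z
    rw [θ, contract_map, lapply_comp_inner_left hij h₃, contract_zero, map_zero]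
  have hx' : ∀ x : Ex (Fin m), θ ⟨i, hi⟩ (ExteriorAlgebra.map (outer h₃ j) x) =
      ExteriorAlgebra.map (outer h₃ j) (θ i x) := by
    intro x
    rw [θ, contract_map, lapply_comp_outer_left hij h₃]
    rfl
  have hmul : ∀ {a : ℕ} {x : Ex (Fin u)}, x ∈ ⋀[ℤ]^a (Fin u →₀ ℤ) → ∀ z : Ex (Fin p),
      θ ⟨i, hi⟩ (x * ExteriorAlgebra.map (inner h₃ j) z) =
        θ ⟨i, hi⟩ x * ExteriorAlgebra.map (inner h₃ j) z := by
    intro a x hx z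
    have := hz z
    rw [θ] at this ⊢
    rw [contract_mul _ hx, this, mul_zero, smul_zero, add_zero]
  rw [ins, map_add, map_smul, hmul (map_outer_θ_mem h₃ j hx), hx',
    apply_ite (θ _), hmul (map_mem _ _ _ hx), hx', map_zero]

/-- The sign of the term of the parallel axiom in which both inputs are replaced. -/
theorem parallel_sign (k l q : ℕ) :
    (-1 : ℤ) ^ (k + l) * -(-1) ^ k =
      (-1) ^ (l * q) * ((-1) ^ (k + q) * ((-1) ^ k * (-1) ^ ((q + 1) * (l + 1)))) := by
  have h₁ := neg_one_pow_mul_self q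
  have h₂ := neg_one_pow_mul_self (l * q)
  have h₃ : (q + 1) * (l + 1) = l * q + q + l + 1 := by ring
  rw [h₃]
  simp only [pow_add, pow_one]
  linear_combination ((-1 : ℤ) ^ k * (-1) ^ k * (-1) ^ l) *
    ((-1) ^ (l * q) * (-1) ^ (l * q) * h₁ + h₂)

theorem ins_parallel (h₃ : m + p = u + 1) (h₄ : u + n = t + 1) {j : Fin m} (hij : (i : ℕ) < j)
    (hj : (j : ℕ) + n - 1 < r) (hi : (i : ℕ) < u)
    (hx : x ∈ ⋀[ℤ]^(k + 1) (Fin m →₀ ℤ)) (hy : y ∈ ⋀[ℤ]^(l + 1) (Fin n →₀ ℤ))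
    (hz : z ∈ ⋀[ℤ]^(q + 1) (Fin p →₀ ℤ)) :
    ins h₂ (k + l) q ⟨j + n - 1, hj⟩ (ins h₁ k l i x y) z =
      (-1 : ℤ) ^ (l * q) • ins h₄ (k + q) l ⟨i, hi⟩ (ins h₃ k q j x z) y := by
  have h₅ := outer_comp_outer_parallel h₁ h₂ hij h₃ h₄ hj hi
  have h₆ := outer_comp_inner_parallel h₁ h₂ hij h₄ hj hi
  have h₇ := outer_comp_inner_parallel' h₂ hij h₃ h₄ hj hi
  have hr := θ_ins_right h₁ i (l := l) (y := y) hij hj hx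
  have hl := θ_ins_left i (q := q) (z := z) h₃ hij hi hx
  have hyz : ExteriorAlgebra.map (inner h₂ ⟨j + n - 1, hj⟩) z *
      ExteriorAlgebra.map (inner h₄ ⟨i, hi⟩) y = (-1 : ℤ) ^ ((q + 1) * (l + 1)) •
        (ExteriorAlgebra.map (inner h₄ ⟨i, hi⟩) y *
          ExteriorAlgebra.map (inner h₂ ⟨j + n - 1, hj⟩) z) :=
    mul_swap (map_mem _ _ _ hz) (map_mem _ _ _ hy)
  -- The term in which both inputs are contracted; only there do `y` and `z` have to be swapped.
  set T := ExteriorAlgebra.map (outer h₄ ⟨i, hi⟩ ∘ₗ outer h₃ j) (θ i (θ j x)) *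
    (ExteriorAlgebra.map (inner h₄ ⟨i, hi⟩) y *
      ExteriorAlgebra.map (inner h₂ ⟨j + n - 1, hj⟩) z) with hT
  have hs := parallel_sign k l q
  rcases q with _ | q
  · obtain ⟨d, hd⟩ := exists_dEx_eq hz
    rw [if_pos rfl, hd, AlgHom.commutes, mul_algebraMap] at hl
    rcases l with _ | l
    · obtain ⟨c, hc⟩ := exists_dEx_eq hy
      rw [if_pos rfl, hc, AlgHom.commutes, mul_algebraMap] at hr
      rw [ins_zero h₂ _ d hd, hr, ins_zero h₁ i c hc, ins_zero h₄ _ c hc, hl, ins_zero h₃ j d hd]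
      simp only [map_add, map_smul, map_mul, map_map, h₅, h₆, h₇, add_mul, smul_mul_assoc,
        mul_smul_comm, mul_assoc, hyz]
      linear_combination (norm := module) hs • T
    · rw [if_neg (Nat.succ_ne_zero l), add_zero] at hr
      rw [ins_zero h₂ _ d hd, hr, ins_succ h₁, ins_succ h₄, hl]
      simp only [map_add, map_smul, map_mul, map_map, h₅, h₆, h₇, add_mul, smul_mul_assoc,
        mul_smul_comm, mul_assoc, hyz]
      linear_combination (norm := module) hs • T
  · rw [if_neg (Nat.succ_ne_zero q), add_zero] at hl
    rcases l with _ | l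
    · obtain ⟨c, hc⟩ := exists_dEx_eq hy
      rw [if_pos rfl, hc, AlgHom.commutes, mul_algebraMap] at hr
      rw [ins_succ h₂, hr, ins_zero h₄ _ c hc, hl, ins_succ h₃]
      simp only [map_add, map_smul, map_mul, map_map, h₅, h₆, h₇, add_mul, smul_mul_assoc,
        mul_smul_comm, mul_assoc, hyz]
      linear_combination (norm := module) hs • T
    · rw [if_neg (Nat.succ_ne_zero l), add_zero] at hr
      rw [ins_succ h₂, hr, ins_succ h₄, hl]
      simp only [map_smul, map_mul, map_map, h₅, h₆, h₇, smul_mul_assoc,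
        mul_smul_comm, mul_assoc, hyz]
      linear_combination (norm := module) hs • T

theorem ins_unit_left (h : 1 + n = n + 1) : ins h 0 l 0 (e 0) y = y := by
  have h₁ : θ (0 : Fin 1) (e 0) = 1 := by
    rw [e, θ, contract_ι]
    simp
  have h₂ : inner h 0 = LinearMap.id := by
    refine hom_ext fun a ha => ?_
    rw [inner_δ h 0 a ha]
    simp
  rw [ins, h₁, map_outer_e, h₂, zero_mul, ite_self, add_zero, map_one, one_mul, pow_zero, one_smul,
    ExteriorAlgebra.map_id]
  rfl

theorem ins_unit_right (h : m + 1 = m + 1) (hx : x ∈ ⋀[ℤ]^(k + 1) (Fin m →₀ ℤ)) :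
    ins h k 0 i x (e (0 : Fin 1)) = x := by
  have h₁ : dEx (Fin 1) (e 0) = algebraMap ℤ _ 1 := by
    rw [dEx_apply, e, contract_ι, total_single]
  have h₂ : outer h i = kill i := by
    refine hom_ext fun a ha => ?_
    rw [outer_δ h i a ha, kill_apply, single_eq_δ, δ_apply]
    by_cases h₁ : a = i
    · rw [if_pos h₁, if_pos h₁.symm, one_smul, h₁, sub_self]
    · rw [if_neg h₁, if_neg (Ne.symm h₁), zero_smul, sub_zero, Nat.add_sub_cancel, ite_self]
  have h₃ : ExteriorAlgebra.map (inner h i) (e 0) = e i := by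
    rw [e, ExteriorAlgebra.map_apply_ι, single_eq_δ]
    have := inner_δ h i 0 Nat.one_pos
    simp only [Fin.val_zero] at this ⊢
    rw [this, e, single_eq_δ, Nat.add_zero]
  have h₄ : θ i (θ i x) = 0 := contract_contract _ _
  have h₅ : θ i x * e i = (-1 : ℤ) ^ k • (e i * θ i x) := mul_ι_swap (contract_mem _ _ _ hx) _
  rw [ins_zero h i 1 h₁, h₂, h₃, map_kill, map_kill, h₄, mul_zero, sub_zero, h₅, smul_smul,
    neg_one_pow_mul_self]
  module

end Ins

theorem forget_isOperad : Pasc.forget.IsOperad where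
  unit_comp {n l} y := toEx_injective (by
    rw [toEx_comp, toEx_unit, ins_unit_left])
  comp_unit {m k} i x := toEx_injective (by
    rw [toEx_comp, toEx_unit, ins_unit_right i _ (toEx_mem x)])
  assoc := by
    intro m n p r t u k l q s v w h₁ h₂ h₃ h₄ e₁ e₂ e₃ e₄ i j x y z
    subst e₁ e₃
    apply toEx_injective
    rw [toEx_comp, toEx_comp, toEx_comp, toEx_comp]
    exact ins_assoc h₁ h₂ i h₃ h₄ j _ (toEx_mem x) (toEx_mem y) (toEx_mem z)
  parallel := by
    intro m n p r t u k l q s v w h₁ h₂ h₃ h₄ e₁ e₂ e₃ e₄ i j hij x y z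
    subst e₁ e₃
    apply toEx_injective
    rw [map_zsmul, toEx_comp, toEx_comp, toEx_comp, toEx_comp]
    exact ins_parallel h₁ h₂ i h₃ h₄ hij _ _ (toEx_mem x) (toEx_mem y) (toEx_mem z)

theorem forget_isDifferential : Pasc.forget.IsDifferential Pasc.forgetD where
  d_d x := toEx_injective (by
    rw [toEx_forgetD, toEx_forgetD, dEx_dEx, map_zero])
  leibniz_left := by
    intro m n r k s h e e' i x y
    obtain rfl : k = s := e'
    apply toEx_injective
    rw [toEx_forgetD, toEx_comp, toEx_comp, toEx_forgetD]
    exact dEx_ins_succ_zero h i (toEx_mem x) (toEx_mem y)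
  leibniz_right := by
    intro m n r l s h e e' i x y
    apply toEx_injective
    rw [toEx_forgetD, toEx_comp, toEx_comp, toEx_forgetD]
    exact dEx_ins_zero_succ h i (toEx_mem x)
  leibniz := by
    intro m n r k l s h e e₁ e₂ i x y
    apply toEx_injective
    rw [map_add, map_zsmul, toEx_forgetD, toEx_comp, toEx_comp, toEx_comp, toEx_forgetD,
      toEx_forgetD]
    exact dEx_ins_succ_succ h i (toEx_mem x)

end Pasc

/-! ### Right combs in `Trias'` -/

namespace Trias

open NSOperad Gen3

/-- The generators of `Trias'`. -/
def gen (g : Gen3) : Trias.obj 2 (dim g) := triasData.gen g rfl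

theorem isOperad : Trias.IsOperad := triasData.operad_isOperad

/-- The projection to `Trias'` of linear combinations of monomials of arity three. -/
def element (k : ℕ) : (Fin 2 × Gen3 × Gen3 → ℤ) →ₗ[ℤ] Trias.obj 3 k := triasData.operadElement k

theorem element_c₁ (a b : Gen3) {k : ℕ} (h : dim a + dim b = k) :
    element k (c₁ a b) = Trias.comp (m := 2) (n := 2) rfl h 0 (gen a) (gen b) :=
  triasData.operadElement_single k (0, a, b) h

theorem element_c₂ (a b : Gen3) {k : ℕ} (h : dim a + dim b = k) :
    element k (c₂ a b) = Trias.comp (m := 2) (n := 2) rfl h 1 (gen a) (gen b) :=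
  triasData.operadElement_single k (1, a, b) h

theorem element_eq_zero (k : ℕ) {v : Fin 2 × Gen3 × Gen3 → ℤ} (hv : v ∈ triasData.rel) :
    element k v = 0 :=
  triasData.operadElement_eq_zero k hv

theorem element_eq (k : ℕ) {v w : Fin 2 × Gen3 × Gen3 → ℤ} (h : v - w ∈ triasData.rel) :
    element k v = element k w := by
  rw [← sub_eq_zero, ← map_sub]
  exact element_eq_zero k h

theorem dim_l_add (k : ℕ) : dim l + k = k := Nat.zero_add k

theorem dim_r_add (k : ℕ) : dim r + k = k := Nat.zero_add k

theorem dim_m_add (k : ℕ) : dim m + k = k + 1 := Nat.add_comm 1 k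

/-- The operation `g ∘₂ -`; on `Pasc` the three generators correspond to the ways of adding a
first input. -/
def prepend {n r k s : ℕ} (g : Gen3) (h : 2 + n = r + 1) (e : dim g + k = s) :
    Trias.obj n k →+ Trias.obj r s :=
  Trias.comp h e 1 (gen g)

theorem prepend_prepend {n r t k s v w : ℕ} (a b : Gen3) (h₃ : 2 + n = r + 1)
    (e₃ : dim b + k = s) (h₄ : 2 + r = t + 1) (e₄ : dim a + s = v) (h : 3 + n = t + 1)
    (hw : dim a + dim b = w) (e : w + k = v) (x : Trias.obj n k) :
    prepend a h₄ e₄ (prepend b h₃ e₃ x) =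
      Trias.comp h e (2 : Fin 3) (element w (c₂ a b)) x := by
  rw [element_c₂ a b hw]
  exact (isOperad.assoc (m := 2) (n := 2) rfl h h₃ h₄ hw e e₃ e₄ 1 1 (gen a) (gen b) x).symm

theorem prepend_l_prepend_r {n r t k s v : ℕ} (h₃ : 2 + n = r + 1) (e₃ : dim .r + k = s)
    (e₃' : dim .l + k = s) (h₄ : 2 + r = t + 1) (e₄ : dim .l + s = v) (x : Trias.obj n k) :
    prepend .l h₄ e₄ (prepend .r h₃ e₃ x) = prepend .l h₄ e₄ (prepend .l h₃ e₃' x) := by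
  have e : 0 + k = v := by simp only [dim] at e₃ e₄; omega
  rw [prepend_prepend _ _ h₃ e₃ h₄ e₄ (by omega) rfl e,
    prepend_prepend _ _ h₃ e₃' h₄ e₄ (by omega) rfl e,
    ← element_eq (dim .l + dim .r) (v := c₂ .l .l) (w := c₂ .l .r)
      (Submodule.subset_span (by simp))]
  rfl

theorem prepend_l_prepend_m {n r t k s v : ℕ} (h₃ : 2 + n = r + 1) (e₃ : dim .m + k = s)
    (h₄ : 2 + r = t + 1) (e₄ : dim .l + s = v) (x : Trias.obj n k) :
    prepend .l h₄ e₄ (prepend .m h₃ e₃ x) = 0 := by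
  have e : 1 + k = v := by simp only [dim] at e₃ e₄; omega
  rw [prepend_prepend _ _ h₃ e₃ h₄ e₄ (by omega) rfl e,
    element_eq_zero (dim .l + dim .m) (v := c₂ .l .m) (Submodule.subset_span (by simp)), map_zero,
    AddMonoidHom.zero_apply]

/-- The relations rewrite each monomial `a ∘₁ b` in terms of monomials `a' ∘₂ b'`. -/
theorem exists_comp_zero_eq (a b : Gen3) {k : ℕ} (h : dim a + dim b = k) :
    ∃ (c : ℤ) (a' b' : Gen3) (h' : dim a' + dim b' = k),
      Trias.comp (m := 2) (n := 2) (r := 3) rfl h 0 (gen a) (gen b) =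
        c • Trias.comp (m := 2) (n := 2) rfl h' 1 (gen a') (gen b') := by
  -- It is enough to find for each `a ∘₁ b` a relation in which it is paired with such a monomial.
  suffices H : ∃ (c : ℤ) (a' b' : Gen3), dim a' + dim b' = dim a + dim b ∧
      c₁ a b - c • c₂ a' b' ∈ triasData.rel by
    obtain ⟨c, a', b', h', H⟩ := H
    refine ⟨c, a', b', h'.trans h, ?_⟩
    rw [← element_c₁ a b h, ← element_c₂ a' b' (h'.trans h), ← map_smul]
    exact element_eq k H
  have sub : ∀ {v}, v ∈ ({ c₁ l r - c₂ r l, c₂ l l - c₂ l r, c₁ l l - c₂ l r, c₁ r r - c₁ r l,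
      c₂ r r - c₁ r l, c₁ m r - c₂ r m, c₂ m l - c₁ l m, c₁ m l - c₂ m r, c₁ r m, c₂ l m,
      c₁ m m + c₂ m m } : Set (Fin 2 × Gen3 × Gen3 → ℤ)) → v ∈ triasData.rel :=
    fun hv => Submodule.subset_span hv
  cases a <;> cases b
  · refine ⟨1, l, r, rfl, ?_⟩
    rw [one_smul]
    exact sub (by simp)
  · refine ⟨1, r, l, rfl, ?_⟩
    rw [one_smul]
    exact sub (by simp)
  · refine ⟨1, m, l, rfl, ?_⟩
    rw [one_smul, ← neg_sub]
    exact neg_mem (sub (by simp))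
  · refine ⟨1, r, r, rfl, ?_⟩
    rw [one_smul, ← neg_sub]
    exact neg_mem (sub (by simp))
  · refine ⟨1, r, r, rfl, ?_⟩
    rw [one_smul, ← sub_sub_sub_cancel_right _ _ (c₁ r l)]
    exact sub_mem (sub (by simp)) (sub (by simp))
  · refine ⟨0, r, m, rfl, ?_⟩
    rw [zero_smul, sub_zero]
    exact sub (by simp)
  · refine ⟨1, m, r, rfl, ?_⟩
    rw [one_smul]
    exact sub (by simp)
  · refine ⟨1, r, m, rfl, ?_⟩
    rw [one_smul]
    exact sub (by simp)
  · refine ⟨-1, m, m, rfl, ?_⟩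
    rw [neg_one_smul, sub_neg_eq_add]
    exact sub (by simp)

/-- Linear combinations of right combs `g₁ ∘₂ (g₂ ∘₂ (⋯ ∘₂ (gₙ ∘₂ 1)))`. -/
inductive IsComb : ∀ {n k : ℕ}, Trias.obj n k → Prop
  | unit : IsComb Trias.unit
  | zero {n k : ℕ} : IsComb (0 : Trias.obj n k)
  | add {n k : ℕ} {x y : Trias.obj n k} (hx : IsComb x) (hy : IsComb y) : IsComb (x + y)
  | neg {n k : ℕ} {x : Trias.obj n k} (hx : IsComb x) : IsComb (-x)
  | cons {n r k s : ℕ} (g : Gen3) (h : 2 + n = r + 1) (e : dim g + k = s) {x : Trias.obj n k}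
      (hx : IsComb x) : IsComb (prepend g h e x)

theorem IsComb.zsmul {n k : ℕ} {x : Trias.obj n k} (hx : IsComb x) (c : ℤ) : IsComb (c • x) := by
  induction c using Int.induction_on with
  | zero => rw [zero_smul]; exact .zero
  | succ c ih => rw [add_smul, one_smul]; exact .add ih hx
  | pred c ih => rw [sub_smul, one_smul, sub_eq_add_neg]; exact .add ih (.neg hx)

/-- Right combs are stable under composition with a generator: at the first input the relations
apply after the generator has been moved past the rest of the comb, and at the other inputs the
composition takes place further inside the comb. -/
theorem IsComb.comp_gen {n k : ℕ} {x : Trias.obj n k} (hx : IsComb x) :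
    ∀ {r s : ℕ} (h : n + 2 = r + 1) (g : Gen3) (e : k + dim g = s) (i : Fin n),
      IsComb (Trias.comp h e i x (gen g)) := by
  induction hx with
  | unit =>
    intro r s h g e i
    obtain rfl : r = 2 := by omega
    obtain rfl : s = dim g := by omega
    obtain rfl : i = 0 := Subsingleton.elim _ _
    rw [isOperad.unit_comp, ← isOperad.comp_unit 1 (gen g)]
    exact .cons g _ _ .unit
  | zero =>
    intro r s h g e i
    rw [map_zero, AddMonoidHom.zero_apply]
    exact .zero
  | add _ _ ihx ihy =>
    intro r s h g e i
    rw [map_add, AddMonoidHom.add_apply]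
    exact .add (ihx h g e i) (ihy h g e i)
  | neg _ ih =>
    intro r s h g e i
    rw [map_neg, AddMonoidHom.neg_apply]
    exact .neg (ih h g e i)
  | @cons n r k s g h e x hx ih =>
    intro t v h₂ g' e₂ i
    by_cases hi : (i : ℕ) = 0
    · have hp := isOperad.parallel (m := 2) (n := 2) (p := n) (r := 3) (t := t) (u := r) rfl
        (by omega) h h₂ rfl (by omega) e e₂ 0 1 Nat.zero_lt_one (gen g) (gen g') x
      have hi' : i = ⟨((0 : Fin 2) : ℕ), by omega⟩ := Fin.ext hi
      rw [hi']
      obtain ⟨c, a, b, hab, hc⟩ := exists_comp_zero_eq g g' rfl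
      rw [hc, map_zsmul, AddMonoidHom.zsmul_apply] at hp
      have ha := isOperad.assoc (m := 2) (n := 2) (p := n) (r := 3) (t := t) (u := r) rfl
        (by omega) h (by omega) hab (show _ = v by omega) rfl (by omega) 1 1 (gen a) (gen b) x
      have hp' := congrArg (fun z => (-1 : ℤ) ^ (dim g' * k) • z) hp
      simp only [smul_smul, Pasc.neg_one_pow_mul_self, one_smul] at hp'
      refine Eq.subst (motive := fun z => IsComb z) hp' (.zsmul ?_ _)
      exact Eq.subst (motive := fun z => IsComb z) ha.symm (.cons a _ _ (.cons b _ _ hx))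
    · obtain ⟨j, hj⟩ : ∃ j : Fin n, (i : ℕ) = 1 + j := ⟨⟨i - 1, by omega⟩, by simp only; omega⟩
      have ha := isOperad.assoc (m := 2) (n := n) (p := 2) (r := r) (t := t) (u := n + 1) h
        h₂ (by omega) (by omega) e e₂ rfl (by omega) 1 j (gen g) x (gen g')
      have hi' : i = ⟨((1 : Fin 2) : ℕ) + j, by have := i.2; simp only [Fin.val_one]; omega⟩ :=
        Fin.ext hj
      rw [hi']
      exact Eq.subst (motive := fun z => IsComb z) ha.symm (.cons g _ _ (ih _ g' _ j))

theorem IsComb.comp {n l : ℕ} (y : Trias.obj n l) :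
    ∀ {m r k s : ℕ} (h : m + n = r + 1) (e : k + l = s) (i : Fin m) {x : Trias.obj m k},
      IsComb x → IsComb (Trias.comp h e i x y) := by
  refine triasData.operad_induction (motive := fun n l (y : Trias.obj n l) =>
    ∀ {m r k s : ℕ} (h : m + n = r + 1) (e : k + l = s) (i : Fin m) {x : Trias.obj m k},
      IsComb x → IsComb (Trias.comp h e i x y)) ?_ ?_ ?_ ?_ ?_ ?_ y
  · intro m r k s h e i x hx
    obtain rfl : m = r := by omega
    obtain rfl : k = s := by omega
    exact Eq.subst (motive := fun z => IsComb z) (isOperad.comp_unit i x).symm hx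
  · rintro _ g rfl m r k s h e i x hx
    exact hx.comp_gen h g e i
  · intro n l m r k s h e i x hx
    exact Eq.subst (motive := fun z => IsComb z) (map_zero (Trias.comp h e i x)).symm .zero
  · intro n l y y' ih ih' m r k s h e i x hx
    exact Eq.subst (motive := fun z => IsComb z) (map_add (Trias.comp h e i x) y y').symm
      (.add (ih h e i hx) (ih' h e i hx))
  · intro n l y ih m r k s h e i x hx
    exact Eq.subst (motive := fun z => IsComb z) (map_neg (Trias.comp h e i x) y).symm
      (.neg (ih h e i hx))
  · intro n p u l q w h₃ e₃ j y z ihy ihz m t k v h₄ e₄ i x hx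
    have := i.2
    have := j.2
    have ha := isOperad.assoc (r := m + n - 1) (by omega) (by omega) h₃ h₄ rfl (by omega) e₃ e₄
      i j x y z
    exact Eq.subst (motive := fun z => IsComb z) ha (ihz _ _ _ (ihy _ _ _ hx))

theorem isComb {n k : ℕ} (x : Trias.obj n k) : IsComb x := by
  rw [← isOperad.unit_comp x]
  exact .comp x _ _ _ .unit

/-! ### Spanning sets of `Trias'` -/

/-- The right comb `⊣ ∘₂ (⊣ ∘₂ (⋯ ∘₂ 1))` in dimension zero, and zero in the other dimensions; it
corresponds to the first basis vector of `Pasc`. -/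
def tail : ∀ n k : ℕ, Trias.obj n k
  | 0, _ => 0
  | _ + 1, _ + 1 => 0
  | 1, 0 => Trias.unit
  | n + 2, 0 => prepend l (Nat.add_comm 2 (n + 1)) (dim_l_add 0) (tail (n + 1) 0)

theorem prepend_l_tail {n r k s : ℕ} (h : 2 + n = r + 1) (e : dim l + k = s) (hn : n ≠ 0) :
    prepend l h e (tail n k) = tail r s := by
  obtain ⟨n, rfl⟩ := Nat.exists_eq_add_one_of_ne_zero hn
  obtain rfl : r = n + 2 := by omega
  obtain rfl : k = s := (Nat.zero_add k).symm.trans e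
  cases k with
  | zero => rfl
  | succ k => rw [tail, tail, map_zero]

/-- The element `⊣ ∘₂ x` depends only on the augmentation of `x`. -/
theorem exists_prepend_l_eq {n k : ℕ} {x : Trias.obj n k} (hx : IsComb x) :
    ∀ {r s : ℕ} (h : 2 + n = r + 1) (e : dim l + k = s),
      ∃ c : ℤ, prepend l h e x = c • tail r s := by
  induction hx with
  | unit =>
    intro r s h e
    refine ⟨1, ?_⟩
    rw [one_smul, ← prepend_l_tail h e one_ne_zero, tail]
  | zero =>
    intro r s h e
    exact ⟨0, by rw [map_zero, zero_smul]⟩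
  | add _ _ ihx ihy =>
    intro r s h e
    obtain ⟨c, hc⟩ := ihx h e
    obtain ⟨d, hd⟩ := ihy h e
    exact ⟨c + d, by rw [map_add, hc, hd, add_smul]⟩
  | neg _ ih =>
    intro r s h e
    obtain ⟨c, hc⟩ := ih h e
    exact ⟨-c, by rw [map_neg, hc, neg_smul]⟩
  | @cons n r k s g h₃ e₃ x hx ih =>
    intro t v h₄ e₄
    have hl : ∀ e₃ : dim l + k = s,
        ∃ c : ℤ, prepend l h₄ e₄ (prepend l h₃ e₃ x) = c • tail t v := by
      intro e₃
      obtain ⟨c, hc⟩ := ih h₃ e₃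
      exact ⟨c, by rw [hc, map_zsmul, prepend_l_tail h₄ e₄ (by omega)]⟩
    cases g with
    | l => exact hl e₃
    | r => rw [prepend_l_prepend_r h₃ e₃ e₃]; exact hl e₃
    | m => exact ⟨0, by rw [prepend_l_prepend_m, zero_smul]⟩

/-- The recursive description of the components of `Trias'`: in arity `n + 2` the elements are
`⊢ ∘₂ a + × ∘₂ b`, where in dimension zero a multiple of `tail` takes the place of `× ∘₂ b`. -/
def Splits : ∀ n k : ℕ, Trias.obj n k → Prop
  | 0, _, x => x = 0
  | 1, k, x => ∃ c : ℤ, x = c • tail 1 k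
  | n + 2, 0, x => ∃ (a : Trias.obj (n + 1) 0) (c : ℤ),
      x = prepend r (Nat.add_comm 2 (n + 1)) (dim_r_add 0) a + c • tail (n + 2) 0
  | n + 2, k + 1, x => ∃ (a : Trias.obj (n + 1) (k + 1)) (b : Trias.obj (n + 1) k),
      x = prepend r (Nat.add_comm 2 (n + 1)) (dim_r_add (k + 1)) a +
        prepend m (Nat.add_comm 2 (n + 1)) (dim_m_add k) b

theorem splits {n k : ℕ} (x : Trias.obj n k) : Splits n k x := by
  have hx := isComb x
  induction hx with
  | unit => exact ⟨1, (one_smul ℤ _).symm⟩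
  | @zero n k =>
    match n, k with
    | 0, _ => exact rfl
    | 1, k => exact ⟨0, (zero_smul ℤ _).symm⟩
    | n + 2, 0 => exact ⟨0, 0, by rw [map_zero, zero_smul, add_zero]⟩
    | n + 2, k + 1 => exact ⟨0, 0, by rw [map_zero, map_zero, add_zero]⟩
  | @add n k x y _ _ ihx ihy =>
    match n, k, x, y, ihx, ihy with
    | 0, _, x, y, hx, hy =>
      rw [Splits] at hx hy
      rw [hx, hy, add_zero]
      rfl
    | 1, k, x, y, ⟨c, hx⟩, ⟨d, hy⟩ => exact ⟨c + d, by rw [hx, hy, add_smul]⟩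
    | n + 2, 0, x, y, ⟨a, c, hx⟩, ⟨a', d, hy⟩ =>
      exact ⟨a + a', c + d, by rw [hx, hy, map_add, add_smul]; abel⟩
    | n + 2, k + 1, x, y, ⟨a, b, hx⟩, ⟨a', b', hy⟩ =>
      exact ⟨a + a', b + b', by rw [hx, hy, map_add, map_add]; abel⟩
  | @neg n k x _ ih =>
    match n, k, x, ih with
    | 0, _, x, hx =>
      rw [Splits] at hx
      rw [hx, neg_zero]
      rfl
    | 1, k, x, ⟨c, hx⟩ => exact ⟨-c, by rw [hx, neg_smul]⟩
    | n + 2, 0, x, ⟨a, c, hx⟩ => exact ⟨-a, -c, by rw [hx, map_neg, neg_smul]; abel⟩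
    | n + 2, k + 1, x, ⟨a, b, hx⟩ => exact ⟨-a, -b, by rw [hx, map_neg, map_neg]; abel⟩
  | @cons n r k s g h e x hx ih =>
    cases n with
    | zero =>
      obtain rfl : r = 1 := by omega
      rw [Splits] at ih
      exact ⟨0, by rw [ih, map_zero, zero_smul]⟩
    | succ n =>
      obtain rfl : r = n + 2 := by omega
      cases g with
      | l =>
        obtain rfl : k = s := (Nat.zero_add k).symm.trans e
        obtain ⟨c, hc⟩ := exists_prepend_l_eq hx h e
        cases k with
        | zero => exact ⟨0, c, by rw [hc, map_zero, zero_add]⟩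
        | succ k => exact ⟨0, 0, by rw [hc, map_zero, map_zero, tail, smul_zero, add_zero]⟩
      | r =>
        obtain rfl : k = s := (Nat.zero_add k).symm.trans e
        cases k with
        | zero => exact ⟨x, 0, by rw [zero_smul, add_zero]⟩
        | succ k => exact ⟨x, 0, by rw [map_zero, add_zero]⟩
      | m =>
        obtain rfl : k + 1 = s := (Nat.add_comm k 1).trans e
        exact ⟨0, x, by rw [map_zero, zero_add]⟩

end Trias

/-! ### The comparison of `Trias'` and `Pasc` -/

namespace Pasc

open NSOperad Gen3

/-- The basis vector with index `p` of the exterior algebra, and `0` if `p` is out of range. -/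
noncomputable def ε (r p : ℕ) : Ex (Fin r) := ExteriorAlgebra.ι ℤ (δ r p)

theorem e_eq_ε {r : ℕ} (a : Fin r) : e a = ε r a := by
  rw [e, single_eq_δ, ε]

theorem ε_mem (r p : ℕ) : ε r p ∈ ⋀[ℤ]^1 (Fin r →₀ ℤ) := by
  rw [ExteriorAlgebra.exteriorPower, pow_one]
  exact LinearMap.mem_range_self _ _

theorem ε_mul_mem (r p q : ℕ) : ε r p * ε r q ∈ ⋀[ℤ]^2 (Fin r →₀ ℤ) :=
  mul_mem rfl (ε_mem r p) (ε_mem r q)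

theorem ε_swap (r p q : ℕ) : ε r p * ε r q = -(ε r q * ε r p) := ι_mul_ι_swap _ _

theorem θ_ε_mul {r : ℕ} (i : Fin r) (p : ℕ) (x : Ex (Fin r)) :
    θ i (ε r p * x) = (if (i : ℕ) = p then 1 else 0 : ℤ) • x - ε r p * θ i x := by
  rw [θ, ε, contract_ι_mul, Finsupp.lapply_apply, δ_apply]

theorem θ_ε {r : ℕ} (i : Fin r) (p : ℕ) :
    θ i (ε r p) = algebraMap ℤ _ (if (i : ℕ) = p then 1 else 0 : ℤ) := by
  rw [θ, ε, contract_ι, Finsupp.lapply_apply, δ_apply]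

theorem total_δ {r p : ℕ} (hp : p < r) : total (Fin r) (δ r p) = 1 := by
  rw [δ, dif_pos hp, total_single]

theorem dEx_ε {r p : ℕ} (hp : p < r) : dEx (Fin r) (ε r p) = 1 := by
  rw [dEx_apply, ε, contract_ι, total_δ hp, map_one]

theorem dEx_ε_mul {r p : ℕ} (hp : p < r) (x : Ex (Fin r)) :
    dEx (Fin r) (ε r p * x) = x - ε r p * dEx (Fin r) x := by
  rw [dEx_apply, dEx_apply, ε, contract_ι_mul, total_δ hp, one_smul]

theorem map_inner_ε {m n r : ℕ} (h : m + n = r + 1) (i : Fin m) {a : ℕ} (ha : a < n) :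
    ExteriorAlgebra.map (inner h i) (ε n a) = ε r (i + a) := by
  rw [ε, ExteriorAlgebra.map_apply_ι, inner_δ h i a ha, ε]

theorem map_outer_ε {m n r : ℕ} (h : m + n = r + 1) (i : Fin m) {a : ℕ} (ha : a < m) :
    ExteriorAlgebra.map (outer h i) (ε m a) =
      if a = i then 0 else if a < i then ε r a else ε r (a + n - 1) := by
  rw [ε, ExteriorAlgebra.map_apply_ι, outer_δ h i a ha]
  split_ifs
  · exact map_zero _
  · rfl
  · rfl

/-- The values of the generators: `⊣` and `⊢` correspond to the first and the second basis vector,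
and `×` to the product of the second and the first one. -/
noncomputable def genEx : Gen3 → Ex (Fin 2)
  | l => ε 2 0
  | r => ε 2 1
  | m => ε 2 1 * ε 2 0

theorem genEx_mem (g : Gen3) : genEx g ∈ ⋀[ℤ]^(dim g + 1) (Fin 2 →₀ ℤ) := by
  cases g
  · exact ε_mem 2 0
  · exact ε_mem 2 1
  · exact ε_mul_mem 2 1 0

/-- The values of the generators, in the components of `Pasc`. -/
noncomputable def genPasc (k : ℕ) (g : Gen3) (hg : triasData.deg g = k) : Pasc.forget.obj 2 k :=
  ⟨genEx g, by subst hg; exact genEx_mem g⟩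

theorem toEx_freeLift_single (k : ℕ) (p : Fin 2 × Gen3 × Gen3) :
    toEx ((freeLift forget_isOperad genPasc).map 3 k
      (QuadData.elementHom triasData.deg k (Pi.single p 1))) =
      if dim p.2.1 + dim p.2.2 = k then
        ins (m := 2) (n := 2) (r := 3) rfl (dim p.2.1) (dim p.2.2) p.1 (genEx p.2.1) (genEx p.2.2) else 0 := by
  rw [QuadData.elementHom_single]
  split_ifs with h₁ h₂ h₂
  · rw [Hom.map_comp]
    exact toEx_comp _ _ _ _ _
  · exact absurd h₁ h₂
  · exact absurd h₂ h₁
  · rw [map_zero, map_zero]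

theorem genPasc_relations (k : ℕ) : triasData.rel ≤ LinearMap.ker
    (((freeLift forget_isOperad genPasc).map 3 k).toIntLinearMap ∘ₗ
      QuadData.elementHom triasData.deg k) := by
  refine Submodule.span_le.2 ?_
  intro v hv
  rw [SetLike.mem_coe, LinearMap.mem_ker]
  apply toEx_injective
  have h₁ : ∀ a b : Gen3, toEx ((freeLift forget_isOperad genPasc).map 3 k
      (QuadData.elementHom triasData.deg k (c₁ a b))) = if dim a + dim b = k then
        ins (m := 2) (n := 2) (r := 3) rfl (dim a) (dim b) 0 (genEx a) (genEx b) else 0 :=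
    fun a b => toEx_freeLift_single k (0, a, b)
  have h₂ : ∀ a b : Gen3, toEx ((freeLift forget_isOperad genPasc).map 3 k
      (QuadData.elementHom triasData.deg k (c₂ a b))) = if dim a + dim b = k then
        ins (m := 2) (n := 2) (r := 3) rfl (dim a) (dim b) 1 (genEx a) (genEx b) else 0 :=
    fun a b => toEx_freeLift_single k (1, a, b)
  have hθ : ∀ (i : Fin 2) (p : ℕ), θ i (ε 2 p) = if (i : ℕ) = p then 1 else 0 := by
    intro i p
    rw [θ_ε]
    split_ifs
    · exact map_one _
    · exact map_zero _
  -- The identity behind `× ∘₁ × = - × ∘₂ ×`.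
  have h3 : ε 3 0 * (ε 3 2 * ε 3 1) = ε 3 2 * (ε 3 1 * ε 3 0) := by
    rw [← mul_assoc, ε_swap 3 0 2, neg_mul, mul_assoc, ε_swap 3 0 1, mul_neg, neg_neg]
  rw [LinearMap.comp_apply, AddMonoidHom.coe_toIntLinearMap]
  simp only [Set.mem_insert_iff, Set.mem_singleton_iff] at hv
  rcases hv with rfl | rfl | rfl | rfl | rfl | rfl | rfl | rfl | rfl | rfl | rfl <;>
    simp only [map_sub, map_add, map_zero, h₁, h₂, dim] <;>
    simp [ins, genEx, hθ, θ_ε_mul, dEx_ε, map_inner_ε, map_outer_ε, ε_swap 3 0 1,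
      ε_swap 3 0 2, h3]
  split_ifs <;> simp

/-- The comparison morphism. -/
noncomputable def comparison : Hom Trias Pasc.forget :=
  triasData.operadLift forget_isOperad genPasc genPasc_relations

/-- The inclusion of `Fin n` in `Fin (n + 1)` as the last inputs. -/
noncomputable abbrev shift {n r : ℕ} (h : 2 + n = r + 1) : (Fin n →₀ ℤ) →ₗ[ℤ] (Fin r →₀ ℤ) :=
  inner h (1 : Fin 2)

/-- A retraction of `shift`, which kills the first basis vector. -/
noncomputable def unshift (n : ℕ) : (Fin (n + 1) →₀ ℤ) →ₗ[ℤ] (Fin n →₀ ℤ) :=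
  Finsupp.linearCombination ℤ (Fin.cases 0 fun a => Finsupp.single a 1)

theorem unshift_comp_shift {n : ℕ} (h : 2 + n = (n + 1) + 1) :
    unshift n ∘ₗ shift h = LinearMap.id := by
  refine hom_ext fun a ha => ?_
  rw [LinearMap.comp_apply, inner_δ h 1 a ha, unshift, δ, dif_pos (by simp only [Fin.val_one]; omega),
    Finsupp.linearCombination_single, one_smul]
  have : (⟨((1 : Fin 2) : ℕ) + a, by simp only [Fin.val_one]; omega⟩ : Fin (n + 1)) =
      Fin.succ ⟨a, ha⟩ := Fin.ext (by simp only [Fin.val_one, Fin.succ_mk]; omega)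
  rw [this, Fin.cases_succ, single_eq_δ]
  rfl

theorem shift_comp_unshift {n : ℕ} (h : 2 + n = (n + 1) + 1) :
    shift h ∘ₗ unshift n = kill 0 := by
  ext a : 1
  refine LinearMap.ext_ring ?_
  simp only [LinearMap.comp_apply, Finsupp.lsingle_apply, unshift,
    Finsupp.linearCombination_single, one_smul, kill_apply]
  refine Fin.cases ?_ (fun a => ?_) a
  · simp
  · rw [Fin.cases_succ, single_eq_δ, inner_δ h 1 a a.2, Finsupp.single_eq_of_ne (Fin.succ_ne_zero a).symm, zero_smul,
      sub_zero, single_eq_δ]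
    congr 1
    simp only [Fin.val_one, Fin.val_succ]
    omega

theorem map_unshift_map_shift {n : ℕ} (h : 2 + n = (n + 1) + 1) (x : Ex (Fin n)) :
    ExteriorAlgebra.map (unshift n) (ExteriorAlgebra.map (shift h) x) = x := by
  rw [map_map, unshift_comp_shift, ExteriorAlgebra.map_id]
  rfl

theorem map_shift_injective {n : ℕ} (h : 2 + n = (n + 1) + 1) :
    Function.Injective (ExteriorAlgebra.map (shift h)) :=
  Function.LeftInverse.injective (map_unshift_map_shift h)

theorem θ_map_shift {n : ℕ} (h : 2 + n = (n + 1) + 1) (x : Ex (Fin n)) :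
    θ 0 (ExteriorAlgebra.map (shift h) x) = 0 := by
  have : Finsupp.lapply 0 ∘ₗ shift h = (0 : (Fin n →₀ ℤ) →ₗ[ℤ] ℤ) := by
    refine hom_ext fun a ha => ?_
    rw [LinearMap.comp_apply, inner_δ h 1 a ha, Finsupp.lapply_apply, δ_apply, if_neg]
    · rfl
    · simp only [Fin.val_zero, Fin.val_one]
      omega
  rw [θ, contract_map, this, contract_zero, map_zero]

/-- The decomposition of the exterior algebra according to the first basis vector. -/
theorem eq_map_shift_add {n : ℕ} (h : 2 + n = (n + 1) + 1) (x : Ex (Fin (n + 1))) :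
    x = ExteriorAlgebra.map (shift h) (ExteriorAlgebra.map (unshift n) x) +
      ε (n + 1) 0 * ExteriorAlgebra.map (shift h) (ExteriorAlgebra.map (unshift n) (θ 0 x)) := by
  have h₀ : θ 0 (θ 0 x) = 0 := contract_contract _ _
  rw [map_map, map_map, shift_comp_unshift, map_kill, map_kill, h₀, mul_zero, sub_zero, e_eq_ε]
  exact (sub_add_cancel x _).symm

theorem toEx_prepend {n r k s : ℕ} (g : Gen3) (h : 2 + n = r + 1) (e : dim g + k = s)
    (x : Trias.obj n k) : toEx (comparison.map r s (Trias.prepend g h e x)) =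
      ins h (dim g) k 1 (genEx g) (toEx (comparison.map n k x)) := by
  rw [Trias.prepend, comparison.map_comp, toEx_comp]
  rfl

theorem toEx_prepend_r {n r k s : ℕ} (h : 2 + n = r + 1) (e : dim .r + k = s)
    (x : Trias.obj n k) : toEx (comparison.map r s (Trias.prepend .r h e x)) =
      ExteriorAlgebra.map (shift h) (toEx (comparison.map n k x)) := by
  rw [toEx_prepend, ins, genEx, θ_ε, map_outer_ε h 1 (by norm_num)]
  simp [dim]

theorem toEx_prepend_m {n r k s : ℕ} (h : 2 + n = r + 1) (e : dim .m + k = s)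
    (x : Trias.obj n k) : toEx (comparison.map r s (Trias.prepend .m h e x)) =
      -(ε r 0 * ExteriorAlgebra.map (shift h) (toEx (comparison.map n k x))) := by
  rw [toEx_prepend, ins, genEx, θ_ε_mul, θ_ε, map_mul, map_outer_ε h 1 (by norm_num)]
  simp [dim, map_outer_ε]

theorem toEx_prepend_l {n r k s : ℕ} (h : 2 + n = r + 1) (e : dim .l + k = s)
    (x : Trias.obj n k) : toEx (comparison.map r s (Trias.prepend .l h e x)) =
      if k = 0 then ε r 0 * ExteriorAlgebra.map (shift h) (dEx _ (toEx (comparison.map n k x)))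
      else 0 := by
  rw [toEx_prepend, ins, genEx, θ_ε, map_outer_ε h 1 (by norm_num)]
  simp [dim]

theorem toEx_tail (n : ℕ) : toEx (comparison.map (n + 1) 0 (Trias.tail (n + 1) 0)) = ε (n + 1) 0 := by
  induction n with
  | zero =>
    rw [Trias.tail, comparison.map_unit, toEx_unit, e_eq_ε]
    rfl
  | succ n ih =>
    rw [Trias.tail, toEx_prepend_l, ih, if_pos rfl, dEx_ε (Nat.succ_pos n), map_one, mul_one]

theorem θ_zero_ε (n : ℕ) : θ 0 (ε (n + 1) 0) = 1 := by
  rw [θ_ε, if_pos (Fin.val_zero _), map_one]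

theorem θ_ε_mul_map_shift {n : ℕ} (h : 2 + n = (n + 1) + 1) (x : Ex (Fin n)) :
    θ 0 (ε (n + 1) 0 * ExteriorAlgebra.map (shift h) x) = ExteriorAlgebra.map (shift h) x := by
  rw [θ_ε_mul, if_pos (Fin.val_zero _), one_smul, θ_map_shift, mul_zero, sub_zero]

/-- The first basis vector is independent of the image of the shift. -/
theorem eq_zero_of_map_shift_add_smul_ε {n : ℕ} {c : ℤ} {x : Ex (Fin n)} (h : 2 + n = (n + 1) + 1)
    (hx : ExteriorAlgebra.map (shift h) x + c • ε (n + 1) 0 = 0) : c = 0 ∧ x = 0 := by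
  have h₁ := congrArg (θ 0) hx
  rw [map_add, θ_map_shift, map_smul, θ_zero_ε, zero_add, map_zero,
    ← Algebra.algebraMap_eq_smul_one] at h₁
  have hc : c = 0 := (ExteriorAlgebra.algebraMap_eq_zero_iff (Fin (n + 1) →₀ ℤ) c).1 h₁
  subst hc
  rw [zero_smul, add_zero] at hx
  exact ⟨rfl, map_shift_injective h (hx.trans (map_zero _).symm)⟩

theorem comparison_injective (n k : ℕ) : Function.Injective (comparison.map n k) := by
  rw [injective_iff_map_eq_zero]
  induction n generalizing k with
  | zero => exact fun x _ => Trias.splits x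
  | succ n ih =>
    intro x hx
    have hx' : toEx (comparison.map (n + 1) k x) = 0 := by rw [hx, map_zero]
    have hs := Trias.splits x
    match n, k, x, hs with
    | 0, 0, x, ⟨c, hc⟩ =>
      rw [hc, map_zsmul, map_zsmul, toEx_tail] at hx'
      have h₀ := (eq_zero_of_map_shift_add_smul_ε (n := 0) (c := c) (x := 0) rfl 
        (by rw [map_zero]; exact (zero_add _).trans hx')).1
      rw [hc, h₀, zero_smul]
    | 0, k + 1, x, ⟨c, hc⟩ => rw [hc, Trias.tail, smul_zero]
    | n + 1, 0, x, ⟨a, c, hc⟩ =>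
      rw [hc, map_add, map_add, map_zsmul, map_zsmul, toEx_tail, toEx_prepend_r] at hx'
      obtain ⟨h₀, ha⟩ := eq_zero_of_map_shift_add_smul_ε _ hx'
      have ha' := ih 0 a (toEx_injective (ha.trans (map_zero _).symm))
      rw [hc, h₀, ha', zero_smul, map_zero, add_zero]
    | n + 1, k + 1, x, ⟨a, b, hc⟩ =>
      rw [hc, map_add, map_add, toEx_prepend_r, toEx_prepend_m] at hx'
      have h₁ := congrArg (θ 0) hx'
      rw [map_add, θ_map_shift, map_neg, θ_ε_mul_map_shift, zero_add, map_zero,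
        neg_eq_zero] at h₁
      have hb := map_shift_injective _ (h₁.trans (map_zero _).symm)
      rw [h₁, mul_zero, neg_zero, add_zero] at hx'
      have ha := map_shift_injective _ (hx'.trans (map_zero _).symm)
      have ha' := ih (k + 1) a (toEx_injective (ha.trans (map_zero _).symm))
      have hb' := ih k b (toEx_injective (hb.trans (map_zero _).symm))
      rw [hc, ha', hb', map_zero, map_zero, add_zero]

theorem eq_zero_of_fin_zero {k : ℕ} {x : Ex (Fin 0)} (hx : x ∈ ⋀[ℤ]^(k + 1) (Fin 0 →₀ ℤ)) :
    x = 0 := by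
  rw [ExteriorAlgebra.exteriorPower, pow_succ'] at hx
  induction hx using Submodule.mul_induction_on' with
  | mem_mul_mem a ha b hb =>
    obtain ⟨v, rfl⟩ := ha
    rw [Subsingleton.elim v 0, map_zero, zero_mul]
  | add a _ b _ ha hb => rw [ha, hb, add_zero]

theorem exists_comparison_eq (n k : ℕ) {x : Ex (Fin n)} (hx : x ∈ ⋀[ℤ]^(k + 1) (Fin n →₀ ℤ)) :
    ∃ y : Trias.obj n k, toEx (comparison.map n k y) = x := by
  induction n generalizing k with
  | zero => exact ⟨0, by rw [map_zero, map_zero, eq_zero_of_fin_zero hx]⟩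
  | succ n ih =>
    have hdec := eq_map_shift_add (Nat.add_comm 2 n) x
    have h₁ : ExteriorAlgebra.map (unshift n) x ∈ ⋀[ℤ]^(k + 1) (Fin n →₀ ℤ) := map_mem _ _ _ hx
    have h₂ : ExteriorAlgebra.map (unshift n) (θ 0 x) ∈ ⋀[ℤ]^k (Fin n →₀ ℤ) :=
      map_mem _ _ _ (contract_mem _ _ _ hx)
    obtain ⟨a, ha⟩ := ih k h₁
    cases k with
    | zero =>
      obtain ⟨c, hc⟩ := exists_eq_algebraMap h₂
      refine ⟨Trias.prepend .r (Nat.add_comm 2 n) (Trias.dim_r_add 0) a + c • Trias.tail (n + 1) 0, ?_⟩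
      rw [map_add, map_add, map_zsmul, map_zsmul, toEx_tail, toEx_prepend_r, ha]
      rw [hc, AlgHom.commutes, mul_algebraMap] at hdec
      exact hdec.symm
    | succ k =>
      obtain ⟨b, hb⟩ := ih k h₂
      refine ⟨Trias.prepend .r (Nat.add_comm 2 n) (Trias.dim_r_add (k + 1)) a +
        -Trias.prepend .m (Nat.add_comm 2 n) (Trias.dim_m_add k) b, ?_⟩
      rw [map_add, map_add, map_neg, map_neg, toEx_prepend_r, toEx_prepend_m, ha, hb, neg_neg]
      exact hdec.symm

theorem comparison_bijective (n k : ℕ) : Function.Bijective (comparison.map n k) := by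
  refine ⟨comparison_injective n k, fun y => ?_⟩
  obtain ⟨x, hx⟩ := exists_comparison_eq n k (toEx_mem y)
  exact ⟨x, toEx_injective hx⟩

/-- The isomorphism between `Trias'` and the nonsymmetric operad underlying `Pasc`. -/
noncomputable def iso : Iso Trias Pasc.forget where
  equiv n k := AddEquiv.ofBijective (comparison.map n k) (comparison_bijective n k)
  map_unit := comparison.map_unit
  map_comp := comparison.map_comp

end Pasc

/-! ### The differential of `Trias'` -/

namespace NSOperad

/-- The differential transported along an isomorphism. -/
def Iso.pullback {P Q : NSOperad} (φ : Iso P Q) (d : Q.Lowering) : P.Lowering := fun n k =>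
  (φ.equiv n k).symm.toAddMonoidHom.comp ((d n k).comp (φ.equiv n (k + 1)).toAddMonoidHom)

theorem Iso.equiv_pullback {P Q : NSOperad} (φ : Iso P Q) (d : Q.Lowering) {n k : ℕ}
    (x : P.obj n (k + 1)) :
    φ.equiv n k (φ.pullback d n k x) = d n k (φ.equiv n (k + 1) x) :=
  (φ.equiv n k).apply_symm_apply _

theorem Iso.isDifferential_pullback {P Q : NSOperad} (φ : Iso P Q) {d : Q.Lowering}
    (hd : Q.IsDifferential d) : P.IsDifferential (φ.pullback d) where
  d_d x := (φ.equiv _ _).injective (by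
    rw [φ.equiv_pullback, φ.equiv_pullback, hd.d_d, map_zero])
  leibniz_left h e e' i x y := (φ.equiv _ _).injective (by
    rw [φ.equiv_pullback, φ.map_comp, φ.map_comp, φ.equiv_pullback, hd.leibniz_left h e e'])
  leibniz_right h e e' i x y := (φ.equiv _ _).injective (by
    rw [φ.equiv_pullback, φ.map_comp, φ.map_comp, φ.equiv_pullback, hd.leibniz_right h e e'])
  leibniz h e e₁ e₂ i x y := (φ.equiv _ _).injective (by
    rw [φ.equiv_pullback, map_add, map_zsmul, φ.map_comp, φ.map_comp, φ.map_comp,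
      φ.equiv_pullback, φ.equiv_pullback, hd.leibniz h e e₁ e₂])

end NSOperad

/-- A differential on a presented operad is determined by its values on the generators. -/
theorem QuadData.IsInducedDifferential.unique {G : Type} [Fintype G] {Q : QuadData G}
    {d d' : Q.operad.Lowering} (hd : Q.IsInducedDifferential d)
    (hd' : Q.IsInducedDifferential d') : d = d' := by
  funext n k
  ext x
  refine Q.operad_induction (motive := fun n k => match k with
    | 0 => fun _ => True
    | k + 1 => fun x => d n k x = d' n k x) ?_ ?_ ?_ ?_ ?_ ?_ x
  · trivial
  · intro k g hg
    cases k with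
    | zero => trivial
    | succ k => exact (hd.2 k g hg).trans (hd'.2 k g hg).symm
  · intro n k
    cases k with
    | zero => trivial
    | succ k => simp only [map_zero]
  · intro n k x y hx hy
    cases k with
    | zero => trivial
    | succ k => simp only [map_add] at hx hy ⊢; rw [hx, hy]
  · intro n k x hx
    cases k with
    | zero => trivial
    | succ k => simp only [map_neg] at hx ⊢; rw [hx]
  · intro m n r k l s h e i x y hx hy
    cases s with
    | zero => trivial
    | succ s =>
      rcases k with _ | k <;> rcases l with _ | l
      · omega
      · simp only at hy ⊢
        rw [hd.1.leibniz_right h e (by omega), hd'.1.leibniz_right h e (by omega), hy]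
      · simp only at hx ⊢
        rw [hd.1.leibniz_left h e (by omega), hd'.1.leibniz_left h e (by omega), hx]
      · simp only at hx hy ⊢
        rw [hd.1.leibniz h e (by omega) (by omega), hd'.1.leibniz h e (by omega) (by omega), hx, hy]

theorem Pasc.isInducedDifferential_pullback :
    triasData.IsInducedDifferential (Pasc.iso.pullback Pasc.forgetD) := by
  refine ⟨Pasc.iso.isDifferential_pullback Pasc.forget_isDifferential, ?_⟩
  intro k g hg
  cases g with
  | l => exact absurd hg (Nat.succ_ne_zero k).symm
  | r => exact absurd hg (Nat.succ_ne_zero k).symm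
  | m =>
    obtain rfl : k = 0 := (Nat.succ.inj hg).symm
    have hl : triasData.deg .l = 0 := rfl
    have hr : triasData.deg .r = 0 := rfl
    have hsum : (∑ h : Gen3, if e : triasData.deg h = 0 then
        triasData.diff .m h • triasData.gen h e else 0) =
          triasData.gen (k := 0) .l hl - triasData.gen (k := 0) .r hr := by
      have huniv : (Finset.univ : Finset Gen3) = {.l, .r, .m} := rfl
      rw [huniv, Finset.sum_insert (by decide), Finset.sum_insert (by decide),
        Finset.sum_singleton, dif_pos hl, dif_pos hr, dif_neg (by decide), add_zero,
        sub_eq_add_neg]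
      congr 1
      · exact one_smul ℤ _
      · exact neg_one_smul ℤ _
    rw [hsum]
    apply (Pasc.iso.equiv 2 0).injective
    apply Pasc.toEx_injective
    refine (congrArg Pasc.toEx (Pasc.iso.equiv_pullback Pasc.forgetD _)).trans ?_
    change Pasc.dEx (Fin 2) (Pasc.genEx .m) =
      Pasc.toEx (Pasc.iso.equiv 2 0 (triasData.gen (k := 0) .l hl - triasData.gen (k := 0) .r hr))
    have : Pasc.toEx (Pasc.iso.equiv 2 0 (triasData.gen (k := 0) .l hl - triasData.gen (k := 0) .r hr)) =
        Pasc.genEx .l - Pasc.genEx .r := by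
      refine (congrArg Pasc.toEx (map_sub (Pasc.iso.equiv 2 0) _ _)).trans ?_
      exact map_sub Pasc.toEx _ _
    rw [this]
    simp [Pasc.genEx, Pasc.dEx_ε_mul, Pasc.dEx_ε]

theorem mainTheorem7 :
    -- the presentation of `Trias'` is the quadratic dual of that of `K'`
    kData.dual = triasData ∧
    -- `Trias'` and the nonsymmetric operad underlying `Pasc` are operads, and the latter is a
    -- differential graded operad
    Trias.IsOperad ∧ Pasc.forget.IsOperad ∧ Pasc.forget.IsDifferential Pasc.forgetD ∧
    -- `Trias'` has exactly one operadic differential with the prescribed values on the generators,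
    -- and it is then isomorphic, as a differential graded operad, to the one underlying `Pasc`
    ∃ d : Trias.Lowering, triasData.IsInducedDifferential d ∧
      (∀ d' : Trias.Lowering, triasData.IsInducedDifferential d' → d' = d) ∧
      ∃ φ : Trias.Iso Pasc.forget, ∀ (n k : ℕ) (x : Trias.obj n (k + 1)),
        φ.equiv n k (d n k x) = Pasc.forgetD n k (φ.equiv n (k + 1) x) :=
  ⟨kData_dual, Trias.isOperad, Pasc.forget_isOperad, Pasc.forget_isDifferential,
    Pasc.iso.pullback Pasc.forgetD, Pasc.isInducedDifferential_pullback,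
    fun _ hd' => hd'.unique Pasc.isInducedDifferential_pullback,
    Pasc.iso, fun _ _ x => Pasc.iso.equiv_pullback Pasc.forgetD x⟩
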